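/- Let $N\ge 1$, $\mathcal H_N=(\mathbb C^2)^{\otimes N}$, and let $\sigma^\pm_j,\sigma^z_j$ be the Pauli matrices acting on the $j$-th factor, with $\sigma^+=\begin{pmatrix}0&1\\0&0\end{pmatrix}$, $\sigma^-=\begin{pmatrix}0&0\\1&0\end{pmatrix}$, $\sigma^z=\mathrm{diag}(1,-1)$ and $i^{\pm\sigma^z}=\mathrm{diag}(i^{\pm1},i^{\mp1})$. Let $\overline U_{i}\,s\ell(2)$ be the restricted quantum group at $\mathfrak q=i$: the unital algebra with generators $E,F,K^{\pm1}$ and relations $$KEK^{-1}=\mathfrak q^2E,\quad KFK^{-1}=\mathfrak q^{-2}F,\quad EF-FE=\frac{K-K^{-1}}{\mathfrak q-\mathfrak q^{-1}},\quad E^2=F^2=0,\quad K^4=1 .$$ It acts on $\mathcal H_N$ by $$E\mapsto\sum_{j=1}^N\sigma_j^+\, i^{\sigma^z_{j+1}+\dots+\sigma^z_N},\qquad F\mapsto\sum_{j=1}^N i^{-\sigma^z_1-\dots-\sigma^z_{j-1}}\,\sigma^-_j,\qquad K\mapsto i^{\sigma^z_1+\dots+\sigma^z_N}.$$ The lattice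 W-algebra $\mathcal W_N$ is the commutant of this action, i.e. the algebra of all linear operators on $\mathcal H_N$ that commute with the image of $\overline U_i\,s\ell(2)$. Define the lattice fermions, for $1\le j\le N$, by $$c_j^\dagger=i^{\,j-1}\,i^{\sigma^z_1+\dots+\sigma^z_{j-1}}\sigma^+_j,\qquad c_j=i^{-j+1}\,i^{-\sigma^z_1-\dots-\sigma^z_{j-1}}\sigma^-_j .$$ For $1\le k\le N-1$ put $$e_k=c_kc^\dagger_{k+1}+c_{k+1}c_k^\dagger+i\bigl(c_k^\dagger c_k-c_{k+1}^\dagger c_{k+1}\bigr)$$ (the Temperley–Lieb generators), and for $1\le j\le N-2$ put $$WB^+_j=(-1)^j\bigl(c_j^\dagger c_{j+1}^\dagger+i\,c_j^\dagger c_{j+2}^\dagger-c_{j+1}^\dagger c_{j+2}^\dagger\bigr),$$ $$WB^0_j=-\tfrac12\bigl(1+i c_j^\dagger c_{j+1}-c_j^\dagger c_{j+2}+i c_{j+1}^\dagger c_j-2c_{j+1}^\dagger c_{j+1}-i c_{j+1}^\dagger c_{j+2}-c_{j+2}^\dagger c_j-i c_{j+2}^\dagger c_{j+1}\bigr),$$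 $$WB^-_j=(-1)^{j+1}\bigl(c_jc_{j+1}+i\,c_jc_{j+2}-c_{j+1}c_{j+2}\bigr),\qquad WB_j=(c_j+c_{j+2})(c_j^\dagger+c_{j+2}^\dagger)-1 .$$ Let $\mathcal B_N$ be the image of the walled Brauer algebra in $\mathrm{End}(\mathcal H_N)$, i.e. the unital algebra generated by all $e_k$ and all $WB_j$. The action of $g\ell(1|1)$ on $\mathcal H_N$ is generated by $\sum_j i^jc_j^\dagger$, $\sum_j i^jc_j$ and $S^z=\frac12\sum_j\sigma_j^z$. The divided powers act by $$\mathsf e=\sum_{1\le j<k\le N}(-1)^{j+k}i^{1-j-k}c_j^\dagger c_k^\dagger,\qquad \mathsf f=\sum_{1\le j<k\le N}i^{\,j+k-1}c_jc_k ,$$ and $U s\ell(2)$ acts on $\mathrm{End}(\mathcal H_N)$ through the algebra generated by the commutators $[\mathsf e,\cdot\,]$ and $[\mathsf f,\cdot\,]$. Theorem. 1. $\mathcal W_N$ is generated, as a unital algebra, by the $e_k$ ($1\le k\le N-1$) and the $WB^+_j,WB^0_j,WB^-_j$ ($1\le j\le N-2$). 2. $\mathcal B_N$ is the commutant of $g\ell(1|1)$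 on $\mathcal H_N$, and $\mathcal W_N$ is the image of $\mathcal B_N$ under the adjoint action of $U s\ell(2)$, i.e. $\mathcal W_N$ is the linear span of all $u(b)$ with $u\in U s\ell(2)$ and $b\in\mathcal B_N$. 3. If $N\ge2$, then $\dim\mathcal W_N=2^{2N-3}$. -/

import Mathlib

/-! # The open XX spin chain and the restricted quantum group at `q = i` -/

noncomputable section

namespace XXChain

open scoped TensorProduct

/-! ## The restricted quantum group -/

/-- Names of the generators of the restricted quantum group. -/
inductive QGen
  | genE
  | genF
  | genK
  | genKinv

/-- The free-algebra elements attached to the four generators. -/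
abbrev freeGen (x : QGen) : FreeAlgebra ℂ QGen := FreeAlgebra.ι ℂ x

/-- The defining relations of the restricted quantum group of `sl(2)`, where `q` is a primitive
`2p`-th root of unity. -/
inductive QRel (q : ℂ) (p : ℕ) : FreeAlgebra ℂ QGen → FreeAlgebra ℂ QGen → Prop
  | K_mul_Kinv : QRel q p (freeGen .genK * freeGen .genKinv) 1
  | Kinv_mul_K : QRel q p (freeGen .genKinv * freeGen .genK) 1
  | K_E : QRel q p (freeGen .genK * freeGen .genE * freeGen .genKinv) (q ^ 2 • freeGen .genE)
  | K_F : QRel q p (freeGen .genK * freeGen .genF * freeGen .genKinv) ((q ^ 2)⁻¹ • freeGen .genF)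
  | E_F : QRel q p (freeGen .genE * freeGen .genF - freeGen .genF * freeGen .genE)
      ((q - q⁻¹)⁻¹ • (freeGen .genK - freeGen .genKinv))
  | E_pow : QRel q p (freeGen .genE ^ p) 0
  | F_pow : QRel q p (freeGen .genF ^ p) 0
  | K_pow : QRel q p (freeGen .genK ^ (2 * p)) 1

/-- The restricted quantum group of `sl(2)`, as an associative unital complex algebra:
generators `E, F, K, K⁻¹` and the relations `QRel`. -/
abbrev RestrictedQG (q : ℂ) (p : ℕ) : Type := RingQuot (QRel q p)

/-! ## The spin chain and its local operators -/

/-- One site; `![1, 0]` is spin up and `![0, 1]` is spin down. -/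
abbrev Site : Type := Fin 2 → ℂ

/-- The state space `(ℂ²)^{⊗ N}`. -/
def SpinChain (N : ℕ) : Type := ⨂[ℂ] _ : Fin N, Site

instance (N : ℕ) : AddCommGroup (SpinChain N) :=
  inferInstanceAs (AddCommGroup (⨂[ℂ] _ : Fin N, Site))

instance (N : ℕ) : Module ℂ (SpinChain N) :=
  inferInstanceAs (Module ℂ (⨂[ℂ] _ : Fin N, Site))

/-- The algebra of all linear operators on the spin chain. -/
abbrev Op (N : ℕ) : Type := Module.End ℂ (SpinChain N)

def sigmaPlus : Module.End ℂ Site := Matrix.toLin' !![0, 1; 0, 0]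

def sigmaMinus : Module.End ℂ Site := Matrix.toLin' !![0, 0; 1, 0]

def sigmaZ : Module.End ℂ Site := Matrix.toLin' !![1, 0; 0, -1]

/-- The one-site operator `i ^ σᶻ`. -/
def siteK : Module.End ℂ Site := Matrix.toLin' !![Complex.I, 0; 0, Complex.I⁻¹]

/-- The one-site operator `i ^ (-σᶻ)`. -/
def siteKinv : Module.End ℂ Site := Matrix.toLin' !![Complex.I⁻¹, 0; 0, Complex.I]

/-- The product operator `f₁ ⊗ ⋯ ⊗ f_N`. -/
def prodOp {N : ℕ} (f : Fin N → Module.End ℂ Site) : Op N := PiTensorProduct.map f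

/-- The product operator `A ⊗ ⋯ ⊗ A ⊗ B ⊗ C ⊗ ⋯ ⊗ C` with `B` on the site `j`. -/
def strand (N : ℕ) (A B C : Module.End ℂ Site) (j : Fin N) : Op N :=
  prodOp fun l => if l < j then A else if l = j then B else C

/-! ## The action of the restricted quantum group at `q = i` -/

/-- The action of `E`, by the iterated comultiplication:
`∑ⱼ 1 ⊗ ⋯ ⊗ 1 ⊗ σ⁺ ⊗ i^{σᶻ} ⊗ ⋯ ⊗ i^{σᶻ}`. -/
def chainE (N : ℕ) : Op N := ∑ j : Fin N, strand N 1 sigmaPlus siteK j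

/-- The action of `F`, by the iterated comultiplication:
`∑ⱼ i^{-σᶻ} ⊗ ⋯ ⊗ i^{-σᶻ} ⊗ σ⁻ ⊗ 1 ⊗ ⋯ ⊗ 1`. -/
def chainF (N : ℕ) : Op N := ∑ j : Fin N, strand N siteKinv sigmaMinus 1 j

/-- The action of `K`: `i^{σᶻ} ⊗ ⋯ ⊗ i^{σᶻ}`. -/
def chainK (N : ℕ) : Op N := prodOp fun _ => siteK

/-- The action of `K⁻¹`. -/
def chainKinv (N : ℕ) : Op N := prodOp fun _ => siteKinv

/-- The action of the generators. -/
def chainGen (N : ℕ) : QGen → Op N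
  | .genE => chainE N
  | .genF => chainF N
  | .genK => chainK N
  | .genKinv => chainKinv N

section Relations

lemma toLin_mul (A B : Matrix (Fin 2) (Fin 2) ℂ) :
    (Matrix.toLin' A : Module.End ℂ Site) * Matrix.toLin' B = Matrix.toLin' (A * B) :=
  (Matrix.toLin'_mul A B).symm

lemma neg_one_smul_site (A : Module.End ℂ Site) : (-1 : ℂ) • A = -A := by
  ext; simp

lemma neg_mul_site (A B : Module.End ℂ Site) : -A * B = -(A * B) := by
  ext; simp

lemma siteK_mul_siteKinv : siteK * siteKinv = 1 := by
  rw [siteK, siteKinv, toLin_mul, Module.End.one_eq_id, ← Matrix.toLin'_one]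
  congr 1; ext a b; fin_cases a <;> fin_cases b <;> simp

lemma siteKinv_mul_siteK : siteKinv * siteK = 1 := by
  rw [siteK, siteKinv, toLin_mul, Module.End.one_eq_id, ← Matrix.toLin'_one]
  congr 1; ext a b; fin_cases a <;> fin_cases b <;> simp

lemma siteK_sigmaPlus : siteK * sigmaPlus = (-1 : ℂ) • (sigmaPlus * siteK) := by
  rw [siteK, sigmaPlus, toLin_mul, toLin_mul, ← map_smul]
  congr 1; ext a b; fin_cases a <;> fin_cases b <;> simp

lemma siteK_sigmaMinus : siteK * sigmaMinus = (-1 : ℂ) • (sigmaMinus * siteK) := by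
  rw [siteK, sigmaMinus, toLin_mul, toLin_mul, ← map_smul]
  congr 1; ext a b; fin_cases a <;> fin_cases b <;> simp

lemma siteKinv_sigmaPlus : siteKinv * sigmaPlus = (-1 : ℂ) • (sigmaPlus * siteKinv) := by
  rw [siteKinv, sigmaPlus, toLin_mul, toLin_mul, ← map_smul]
  congr 1; ext a b; fin_cases a <;> fin_cases b <;> simp

lemma siteKinv_sigmaMinus : siteKinv * sigmaMinus = (-1 : ℂ) • (sigmaMinus * siteKinv) := by
  rw [siteKinv, sigmaMinus, toLin_mul, toLin_mul, ← map_smul]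
  congr 1; ext a b; fin_cases a <;> fin_cases b <;> simp

lemma sigmaPlus_sq : sigmaPlus * sigmaPlus = 0 := by
  rw [sigmaPlus, toLin_mul, ← map_zero Matrix.toLin']
  congr 1; ext a b; fin_cases a <;> fin_cases b <;> simp

lemma sigmaMinus_sq : sigmaMinus * sigmaMinus = 0 := by
  rw [sigmaMinus, toLin_mul, ← map_zero Matrix.toLin']
  congr 1; ext a b; fin_cases a <;> fin_cases b <;> simp

lemma siteK_pow_four : siteK ^ 4 = 1 := by
  rw [siteK, ← Matrix.toLin'_pow, Module.End.one_eq_id, ← Matrix.toLin'_one]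
  congr 1; ext a b; fin_cases a <;> fin_cases b <;> simp [pow_succ, Matrix.mul_apply]

lemma site_comm : sigmaPlus * sigmaMinus - sigmaMinus * sigmaPlus =
    (Complex.I - Complex.I⁻¹)⁻¹ • (siteK - siteKinv) := by
  rw [siteK, siteKinv, sigmaPlus, sigmaMinus, toLin_mul, toLin_mul, ← map_sub, ← map_sub,
    ← map_smul]
  have h : Complex.I + Complex.I ≠ 0 := by
    rw [← two_mul]; exact mul_ne_zero two_ne_zero Complex.I_ne_zero
  congr 1; ext a b
  fin_cases a <;> fin_cases b <;> simp [h]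
  rw [← neg_add', mul_neg, inv_mul_cancel₀ h]

variable {N : ℕ}

lemma prodOp_mul (f g : Fin N → Module.End ℂ Site) :
    prodOp f * prodOp g
      = prodOp fun l => f l * g l :=
  (PiTensorProduct.map_mul f g).symm

lemma prodOp_one : prodOp (fun _ : Fin N => 1) = 1 := PiTensorProduct.map_one

lemma prodOp_pow (f : Fin N → Module.End ℂ Site) (n : ℕ) :
    prodOp f ^ n = prodOp fun l => f l ^ n :=
  (PiTensorProduct.map_pow f n).symm

lemma prodOp_update_add (f : Fin N → Module.End ℂ Site) (j : Fin N) (a b : Module.End ℂ Site) :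
    prodOp (Function.update f j (a + b))
      = prodOp (Function.update f j a) + prodOp (Function.update f j b) :=
  PiTensorProduct.map_update_add f j a b

lemma prodOp_update_smul (f : Fin N → Module.End ℂ Site) (j : Fin N) (c : ℂ)
    (a : Module.End ℂ Site) :
    prodOp (Function.update f j (c • a)) = c • prodOp (Function.update f j a) :=
  PiTensorProduct.map_update_smul f j c a

/-- Two product operators that differ by a factor `c` on one site differ by the factor `c`. -/
lemma prodOp_eq_smul {f g : Fin N → Module.End ℂ Site} (j : Fin N) (c : ℂ)
    (hj : f j = c • g j) (h : ∀ l, l ≠ j → f l = g l) :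
    prodOp f = c • prodOp g := by
  have hf : f = Function.update g j (c • g j) := by
    funext l
    by_cases hl : l = j
    · subst hl; simp [hj]
    · simp [hl, h l hl]
  rw [hf, prodOp_update_smul, Function.update_eq_self]

lemma prodOp_eq_sub {f g h : Fin N → Module.End ℂ Site} (j : Fin N)
    (hj : f j = g j - h j) (hg : ∀ l, l ≠ j → g l = f l) (hh : ∀ l, l ≠ j → h l = f l) :
    prodOp f = prodOp g - prodOp h := by
  have h1 : f = Function.update f j (g j + (-1 : ℂ) • h j) := by
    funext l
    by_cases hl : l = j
    · subst hl; simp only [hj, Function.update_self, neg_one_smul_site, sub_eq_add_neg]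
    · simp [hl]
  have h2 : Function.update f j (g j) = g := by
    funext l
    by_cases hl : l = j
    · subst hl; simp
    · simp [hl, hg l hl]
  have h3 : Function.update f j (h j) = h := by
    funext l
    by_cases hl : l = j
    · subst hl; simp
    · simp [hl, hh l hl]
  rw [h1, prodOp_update_add, prodOp_update_smul, h2, h3]
  simp [sub_eq_add_neg]

lemma prodOp_eq_zero {f : Fin N → Module.End ℂ Site} (j : Fin N) (hj : f j = 0) :
    prodOp f = 0 := by
  rw [prodOp_eq_smul (g := f) j 0 (by simp [hj]) (fun _ _ => rfl), zero_smul]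

lemma sq_sum_eq_zero (X : Fin N → Op N) (h : ∀ j k, X j * X k = (-1 : ℂ) • (X k * X j)) :
    (∑ j, X j) ^ 2 = 0 := by
  have h1 : (∑ j, X j) ^ 2 = ∑ j, ∑ k, X j * X k := by
    rw [sq, Finset.sum_mul_sum]
  have h2 : (∑ j, X j) ^ 2 = (-1 : ℂ) • (∑ j, X j) ^ 2 := by
    nth_rewrite 1 [h1]
    rw [Finset.sum_comm, h1, Finset.smul_sum]
    refine Finset.sum_congr rfl fun j _ => ?_
    rw [Finset.smul_sum]
    exact Finset.sum_congr rfl fun k _ => h k j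
  have h3 : (2 : ℂ) • (∑ j, X j) ^ 2 = 0 := by
    rw [two_smul]; nth_rewrite 1 [h2]; simp
  exact (smul_eq_zero.mp h3).resolve_left two_ne_zero

lemma strandE_anti (j k : Fin N) : strand N 1 sigmaPlus siteK j * strand N 1 sigmaPlus siteK k
    = (-1 : ℂ) • (strand N 1 sigmaPlus siteK k * strand N 1 sigmaPlus siteK j) := by
  have key : ∀ j k : Fin N, j < k →
      strand N 1 sigmaPlus siteK j * strand N 1 sigmaPlus siteK k
      = (-1 : ℂ) • (strand N 1 sigmaPlus siteK k * strand N 1 sigmaPlus siteK j) := by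
    intro j k hjk
    simp only [strand, prodOp_mul]
    refine prodOp_eq_smul k _ ?_ ?_
    · simp [hjk.not_gt, hjk.ne', siteK_sigmaPlus]
    · intro l hl
      rcases lt_trichotomy l j with h | h | h
      · simp [h, h.trans hjk]
      · subst h; simp [hjk]
      · rcases lt_trichotomy l k with h' | h' | h'
        · simp [h.not_gt, h.ne', h']
        · exact absurd h' hl
        · simp [h.not_gt, h.ne', h'.not_gt, h'.ne']
  rcases lt_trichotomy j k with h | h | h
  · exact key j k h
  · subst h
    have : strand N 1 sigmaPlus siteK j * strand N 1 sigmaPlus siteK j = 0 := by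
      simp only [strand, prodOp_mul]
      exact prodOp_eq_zero j (by simp [sigmaPlus_sq])
    rw [this, smul_zero]
  · rw [key k j h, smul_smul]; simp

lemma strandF_anti (j k : Fin N) :
    strand N siteKinv sigmaMinus 1 j * strand N siteKinv sigmaMinus 1 k
    = (-1 : ℂ) • (strand N siteKinv sigmaMinus 1 k * strand N siteKinv sigmaMinus 1 j) := by
  have key : ∀ j k : Fin N, j < k →
      strand N siteKinv sigmaMinus 1 k * strand N siteKinv sigmaMinus 1 j
      = (-1 : ℂ) • (strand N siteKinv sigmaMinus 1 j * strand N siteKinv sigmaMinus 1 k) := by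
    intro j k hjk
    simp only [strand, prodOp_mul]
    refine prodOp_eq_smul j _ ?_ ?_
    · simp [hjk, siteKinv_sigmaMinus]
    · intro l hl
      rcases lt_trichotomy l j with h | h | h
      · simp [h, h.trans hjk]
      · exact absurd h hl
      · rcases lt_trichotomy l k with h' | h' | h'
        · simp [h.not_gt, h.ne', h']
        · subst h'; simp [h.not_gt, h.ne']
        · simp [h.not_gt, h.ne', h'.not_gt, h'.ne']
  rcases lt_trichotomy j k with h | h | h
  · rw [key j k h, smul_smul]; simp
  · subst h
    have : strand N siteKinv sigmaMinus 1 j * strand N siteKinv sigmaMinus 1 j = 0 := by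
      simp only [strand, prodOp_mul]
      exact prodOp_eq_zero j (by simp [sigmaMinus_sq])
    rw [this, smul_zero]
  · exact key k j h

lemma strand_EF_comm {j k : Fin N} (hjk : j ≠ k) :
    strand N 1 sigmaPlus siteK j * strand N siteKinv sigmaMinus 1 k
    = strand N siteKinv sigmaMinus 1 k * strand N 1 sigmaPlus siteK j := by
  simp only [strand, prodOp_mul]
  rcases lt_or_gt_of_ne hjk with h | h
  · have step : ∀ f g : Fin N → Module.End ℂ Site,
        g j = (-1 : ℂ) • f j → f k = (-1 : ℂ) • g k → (∀ l, l ≠ j → l ≠ k → f l = g l) →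
        prodOp f = prodOp g := by
      intro f g h1 h2 h3
      rw [prodOp_eq_smul (f := f) (g := Function.update f k (g k)) k (-1) (by simpa using h2)
          (by intro l hl; simp [hl]),
        prodOp_eq_smul (f := g) (g := Function.update f k (g k)) j (-1)
          (by simpa [Function.update_of_ne hjk] using h1)]
      intro l hl
      by_cases hlk : l = k
      · subst hlk; simp
      · simp [hlk, h3 l hl hlk]
    refine step _ _ ?_ ?_ ?_
    · simp [h, siteKinv_sigmaPlus]
    · simp [h.not_gt, h.ne', siteK_sigmaMinus]
    · intro l hlj hlk
      rcases lt_trichotomy l j with h' | h' | h'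
      · simp [h', h'.trans h]
      · exact absurd h' hlj
      · rcases lt_trichotomy l k with h'' | h'' | h''
        · simp [h'.not_gt, h'.ne', h'', siteK_mul_siteKinv, siteKinv_mul_siteK]
        · exact absurd h'' hlk
        · simp [h'.not_gt, h'.ne', h''.not_gt, h''.ne']
  · congr 1
    funext l
    rcases lt_trichotomy l k with h' | h' | h'
    · simp [h', h'.trans h]
    · subst h'; simp [h]
    · rcases lt_trichotomy l j with h'' | h'' | h''
      · simp [h'.not_gt, h'.ne', h'']
      · subst h''; simp [h'.not_gt, h'.ne']
      · simp [h'.not_gt, h'.ne', h''.not_gt, h''.ne']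

/-- The operator `K⁻¹ ⊗ ⋯ ⊗ K⁻¹ ⊗ K ⊗ ⋯ ⊗ K` with `m` factors `K⁻¹`. -/
def domainWall (N m : ℕ) : Op N :=
  prodOp fun l : Fin N => if l.val < m then siteKinv else siteK

lemma strand_EF_diag (j : Fin N) :
    strand N 1 sigmaPlus siteK j * strand N siteKinv sigmaMinus 1 j
      - strand N siteKinv sigmaMinus 1 j * strand N 1 sigmaPlus siteK j
    = (Complex.I - Complex.I⁻¹)⁻¹ • (domainWall N j.val - domainWall N (j.val + 1)) := by
  have h1 : strand N 1 sigmaPlus siteK j * strand N siteKinv sigmaMinus 1 j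
      - strand N siteKinv sigmaMinus 1 j * strand N 1 sigmaPlus siteK j
      = strand N siteKinv (sigmaPlus * sigmaMinus - sigmaMinus * sigmaPlus) siteK j := by
    simp only [strand, prodOp_mul]
    refine (prodOp_eq_sub j ?_ ?_ ?_).symm
    · simp
    all_goals
      intro l hl
      rcases lt_trichotomy l j with h | h | h
      · simp [h]
      · exact absurd h hl
      · simp [h.not_gt, h.ne']
  have h2 : domainWall N j.val - domainWall N (j.val + 1)
      = strand N siteKinv (siteK - siteKinv) siteK j := by
    simp only [strand, domainWall]
    refine (prodOp_eq_sub j ?_ ?_ ?_).symm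
    · simp
    all_goals
      intro l hl
      rcases lt_trichotomy l j with h | h | h
      · have h' : l.val < j.val := h
        simp [h, h', Nat.lt_succ_of_lt h']
      · exact absurd h hl
      · have h' : j.val < l.val := h
        have h'' : ¬ l.val < j.val + 1 := by omega
        simp [h.not_gt, h.ne', h'']
  rw [h1, h2, site_comm]
  refine prodOp_eq_smul j _ (by simp) ?_
  intro l hl
  simp [hl]

lemma chain_EF : chainE N * chainF N - chainF N * chainE N
    = (Complex.I - Complex.I⁻¹)⁻¹ • (chainK N - chainKinv N) := by
  have hK : chainK N = domainWall N 0 := by simp [chainK, domainWall]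
  have hKi : chainKinv N = domainWall N N := by simp [chainKinv, domainWall]
  rw [hK, hKi, ← Finset.sum_range_sub' (fun i => domainWall N i), ← Fin.sum_univ_eq_sum_range
    (fun i => domainWall N i - domainWall N (i + 1)), Finset.smul_sum]
  simp only [← strand_EF_diag]
  rw [chainE, chainF, Finset.sum_mul_sum, Finset.sum_mul_sum,
    Finset.sum_comm (f := fun i j => strand N siteKinv sigmaMinus 1 i *
      strand N 1 sigmaPlus siteK j), ← Finset.sum_sub_distrib]
  refine Finset.sum_congr rfl fun j _ => ?_
  rw [← Finset.sum_sub_distrib]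
  refine Finset.sum_eq_single j (fun k _ hk => ?_) (by simp)
  rw [strand_EF_comm hk.symm, sub_self]

lemma chainK_mul_chainKinv : chainK N * chainKinv N = 1 := by
  simp only [chainK, chainKinv, prodOp_mul, siteK_mul_siteKinv]
  exact prodOp_one

lemma chainKinv_mul_chainK : chainKinv N * chainK N = 1 := by
  simp only [chainK, chainKinv, prodOp_mul, siteKinv_mul_siteK]
  exact prodOp_one

lemma chain_K_E : chainK N * chainE N * chainKinv N = Complex.I ^ 2 • chainE N := by
  simp only [chainE, Finset.mul_sum, Finset.sum_mul, Finset.smul_sum]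
  refine Finset.sum_congr rfl fun j _ => ?_
  simp only [chainK, chainKinv, strand, prodOp_mul]
  refine prodOp_eq_smul j _ ?_ ?_
  · have h : siteK * sigmaPlus * siteKinv = -sigmaPlus := by
      rw [siteK_sigmaPlus, neg_one_smul_site, neg_mul_site, mul_assoc, siteK_mul_siteKinv, mul_one]
    simp [h, neg_one_smul_site]
  · intro l hl
    rcases lt_trichotomy l j with h | h | h
    · simp [h, siteK_mul_siteKinv]
    · exact absurd h hl
    · simp [h.not_gt, h.ne', mul_assoc, siteK_mul_siteKinv]

lemma chain_K_F : chainK N * chainF N * chainKinv N = (Complex.I ^ 2)⁻¹ • chainF N := by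
  simp only [chainF, Finset.mul_sum, Finset.sum_mul, Finset.smul_sum]
  refine Finset.sum_congr rfl fun j _ => ?_
  simp only [chainK, chainKinv, strand, prodOp_mul]
  refine prodOp_eq_smul j _ ?_ ?_
  · have h : siteK * sigmaMinus * siteKinv = -sigmaMinus := by
      rw [siteK_sigmaMinus, neg_one_smul_site, neg_mul_site, mul_assoc, siteK_mul_siteKinv, mul_one]
    simp [h, neg_one_smul_site]
  · intro l hl
    rcases lt_trichotomy l j with h | h | h
    · simp [h, siteK_mul_siteKinv]
    · exact absurd h hl
    · simp [h.not_gt, h.ne', siteK_mul_siteKinv]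

lemma chainK_pow_four : chainK N ^ 4 = 1 := by
  rw [chainK, prodOp_pow]
  simp only [siteK_pow_four]
  exact prodOp_one

lemma chainGen_rel (N : ℕ) ⦃x y : FreeAlgebra ℂ QGen⦄ (h : QRel Complex.I 2 x y) :
    FreeAlgebra.lift ℂ (chainGen N) x = FreeAlgebra.lift ℂ (chainGen N) y := by
  cases h <;> simp only [freeGen, map_mul, map_sub, map_pow, map_smul, map_one, map_zero,
    FreeAlgebra.lift_ι_apply, chainGen]
  · exact chainK_mul_chainKinv
  · exact chainKinv_mul_chainK
  · exact chain_K_E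
  · exact chain_K_F
  · exact chain_EF
  · exact sq_sum_eq_zero _ strandE_anti
  · exact sq_sum_eq_zero _ strandF_anti
  · exact chainK_pow_four

end Relations

/-- The tensor-product representation of the restricted quantum group at `q = i` (`p = 2`) on the
spin chain. -/
def chainRep (N : ℕ) : RestrictedQG Complex.I 2 →ₐ[ℂ] Op N :=
  RingQuot.liftAlgHom ℂ ⟨FreeAlgebra.lift ℂ (chainGen N), chainGen_rel N⟩

/-- The lattice W-algebra: all operators that commute with the restricted quantum group. -/
def latticeW (N : ℕ) : Subalgebra ℂ (Op N) :=
  Subalgebra.centralizer ℂ (Set.range (chainRep N))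

/-! ## Lattice fermions

Sites are numbered `1, …, N` in the formulas; the site `j : Fin N` has the number `j + 1`. -/

/-- The fermion `c†ⱼ`, by the Jordan–Wigner transformation. -/
def cdag {N : ℕ} (j : Fin N) : Op N :=
  Complex.I ^ j.val • strand N siteK sigmaPlus 1 j

/-- The fermion `cⱼ`, by the Jordan–Wigner transformation. -/
def cann {N : ℕ} (j : Fin N) : Op N :=
  Complex.I⁻¹ ^ j.val • strand N siteKinv sigmaMinus 1 j

/-- The number of a site, counted from one. -/
def pos {N : ℕ} (j : Fin N) : ℤ := (j.val : ℤ) + 1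

/-! ## The generators of the lattice W-algebra -/

/-- The Temperley–Lieb generator on the neighbouring sites `j, k`. -/
def tlGen {N : ℕ} (j k : Fin N) : Op N :=
  cann j * cdag k + cann k * cdag j
    + Complex.I • (cdag j * cann j - cdag k * cann k)

/-- The bilinear `WB⁺` on the consecutive sites `j, k, l`. -/
def wbPlus {N : ℕ} (j k l : Fin N) : Op N :=
  (-1 : ℂ) ^ pos j •
    (cdag j * cdag k + Complex.I • (cdag j * cdag l) - cdag k * cdag l)

/-- The bilinear `WB⁰` on the consecutive sites `j, k, l`. -/
def wbZero {N : ℕ} (j k l : Fin N) : Op N :=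
  (-(1 / 2) : ℂ) •
    (1 + Complex.I • (cdag j * cann k) - cdag j * cann l + Complex.I • (cdag k * cann j)
      - (2 : ℂ) • (cdag k * cann k) - Complex.I • (cdag k * cann l) - cdag l * cann j
      - Complex.I • (cdag l * cann k))

/-- The bilinear `WB⁻` on the consecutive sites `j, k, l`. -/
def wbMinus {N : ℕ} (j k l : Fin N) : Op N :=
  (-1 : ℂ) ^ (pos j + 1) •
    (cann j * cann k + Complex.I • (cann j * cann l) - cann k * cann l)

/-- The walled Brauer generator on the sites `j` and `l = j + 2`, the permutation of the
tensor factors `j` and `l` in the alternating `gl(1|1)` chain, written with fermions. -/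
def wbPerm {N : ℕ} (j l : Fin N) : Op N :=
  (cann j + cann l) * (cdag j + cdag l) - 1

/-- The Temperley–Lieb generators `e₁, …, e_{N-1}`. -/
def tlGenerators (N : ℕ) : Set (Op N) :=
  {x | ∃ j k : Fin N, j.val + 1 = k.val ∧ x = tlGen j k}

/-- The bilinears `WB⁺ⱼ, WB⁰ⱼ, WB⁻ⱼ` for `1 ≤ j ≤ N - 2`. -/
def wGenerators (N : ℕ) : Set (Op N) :=
  {x | ∃ j k l : Fin N, j.val + 1 = k.val ∧ k.val + 1 = l.val ∧
    (x = wbPlus j k l ∨ x = wbZero j k l ∨ x = wbMinus j k l)}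

/-- The walled Brauer permutations `WBⱼ` for `1 ≤ j ≤ N - 2`. -/
def permGenerators (N : ℕ) : Set (Op N) :=
  {x | ∃ j l : Fin N, j.val + 2 = l.val ∧ x = wbPerm j l}

/-! ## The walled Brauer algebra and `gl(1|1)` -/

/-- The image of the walled Brauer algebra in the operators on the spin chain: the unital
subalgebra generated by all `eₖ` and all `WBⱼ`. -/
def walledBrauer (N : ℕ) : Subalgebra ℂ (Op N) :=
  Algebra.adjoin ℂ (tlGenerators N ∪ permGenerators N)

/-- The odd generator `F† = ∑ⱼ iʲ c†ⱼ` of `gl(1|1)`. -/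
def glPsiDag (N : ℕ) : Op N := ∑ j : Fin N, Complex.I ^ pos j • cdag j

/-- The odd generator `F = ∑ⱼ iʲ cⱼ` of `gl(1|1)`. -/
def glPsi (N : ℕ) : Op N := ∑ j : Fin N, Complex.I ^ pos j • cann j

/-- The total spin `Sᶻ = ½ ∑ⱼ σᶻⱼ`, the number operator of `gl(1|1)` up to a constant. -/
def totalSpin (N : ℕ) : Op N := (1 / 2 : ℂ) • ∑ j : Fin N, strand N 1 sigmaZ 1 j

/-- The operators that commute with `gl(1|1)`. The remaining, central, generator of `gl(1|1)` is
the anticommutator of the two odd ones, a scalar. -/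
def glCommutant (N : ℕ) : Subalgebra ℂ (Op N) :=
  Subalgebra.centralizer ℂ {glPsiDag N, glPsi N, totalSpin N}

/-! ## The adjoint action of the divided powers -/

/-- The divided power `e`: `∑_{j<k} (-1)^{j+k} i^{1-j-k} c†ⱼ c†ₖ`. -/
def divE (N : ℕ) : Op N :=
  ∑ j : Fin N, ∑ k : Fin N with j < k,
    ((-1 : ℂ) ^ (pos j + pos k) * Complex.I ^ (1 - pos j - pos k)) • (cdag j * cdag k)

/-- The divided power `f`: `∑_{j<k} i^{j+k-1} cⱼ cₖ`. -/
def divF (N : ℕ) : Op N :=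
  ∑ j : Fin N, ∑ k : Fin N with j < k,
    Complex.I ^ (pos j + pos k - 1) • (cann j * cann k)

/-- The adjoint action `ad x : y ↦ x y - y x`. -/
def adOp {N : ℕ} (x : Op N) : Module.End ℂ (Op N) :=
  LinearMap.mulLeft ℂ x - LinearMap.mulRight ℂ x

/-- The algebra through which the enveloping algebra of `sl(2)` acts on the operators: it is
generated by `ad e` and `ad f`. -/
def adjointSl2 (N : ℕ) : Subalgebra ℂ (Module.End ℂ (Op N)) :=
  Algebra.adjoin ℂ {adOp (divE N), adOp (divF N)}

/-- The image of a space `B` of operators under the adjoint `sl(2)` action: the span of all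
`u(b)` with `u` in the image of the enveloping algebra of `sl(2)` and `b` in `B`. -/
def adjointImage (N : ℕ) (B : Submodule ℂ (Op N)) : Submodule ℂ (Op N) :=
  Submodule.span ℂ {x | ∃ u ∈ adjointSl2 N, ∃ b ∈ B, x = u b}

end XXChain

end

/-! The proof rests on the bond fermions `aₖ = cₖ + i cₖ₊₁` and `a†ₖ = c†ₖ + i c†ₖ₊₁`. They
anticommute with both zero modes `ψ = ∑ iʲ cⱼ` and `ψ† = ∑ iʲ c†ⱼ`, and their only nonzero
anticommutators are those of `a` and `a†` on neighbouring bonds, equal to `i`. On the chain `K` is a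
scalar multiple of the parity, `F` of `ψ`, and `E = ψ† K`; so the W-algebra is the commutant of
parity, `ψ` and `ψ†` (`latticeW_eq_centralizer`).

Commutants. The bonds together with `c₀, c†₀` generate everything, and normal ordering writes each
operator as a combination of `1, c₀, c†₀, c₀c†₀` with coefficients in the bond algebra. The
supercommutators with `ψ` and `ψ†` kill the bond algebra and differentiate `c†₀` and `c₀`; hence
their common kernel is the bond algebra. Its even part is generated by products of two bonds
(`quad_eq_centralizer`), its charge-zero part by the hopping terms `a†ⱼaₖ`
(`hopAlg_eq_centralizer`).

Generators. One has `eₖ = i a†ₖaₖ`; `WB⁺` and `WB⁻` are signs times `a†a†` and `aa` on neighbouring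
bonds; `WB⁰` and `WB` supply the symmetric hop `a†ⱼaₖ + a†ₖaⱼ`. Commutators with `a†ₖaₖ` give the
antisymmetric hop and carry a bond fermion along the chain, so all bilinears are reached (`quad_le`,
`bondDag_mul_bond_mem`).

Adjoint action. The divided powers send `aₖ` to a multiple of `a†ₖ` and back, so each bond is an
`sl(2)` doublet whose weight is the charge. The W-algebra has only even charges, and a vector of
even weight comes from weight zero by a power of `e` or `f`; weight zero is the walled Brauer image
(`quad_eq_span`).

Dimension. The kernel of `ψ`, then of `ψ†`, then the even part each halve the dimension, from
`2^(2N)` to `2^(2N-3)` (`finrank_quad`). -/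

noncomputable section

namespace XXChain

open Complex (I)
open scoped TensorProduct

/-! ## Linear algebra -/

section General

variable {A : Type*} [Ring A] [Algebra ℂ A]

/-- The commutator map `y ↦ x y - y x`. -/
def commMap (x : A) : Module.End ℂ A := LinearMap.mulLeft ℂ x - LinearMap.mulRight ℂ x

@[simp] lemma commMap_apply (x y : A) : commMap x y = x * y - y * x := rfl

lemma commMap_mul (x y z : A) : commMap x (y * z) = commMap x y * z + y * commMap x z := by
  simp only [commMap_apply]; noncomm_ring

/-- The set of `x` with `x T ⊆ T` is a subalgebra; applied to `1 ∈ T` this puts `x` itself in `T`.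
Normal forms and gradings of generated algebras are obtained this way. -/
lemma adjoin_le_of_mul_mem (s : Set A) (T : Submodule ℂ A) (h1 : 1 ∈ T)
    (hs : ∀ g ∈ s, ∀ t ∈ T, g * t ∈ T) : Subalgebra.toSubmodule (Algebra.adjoin ℂ s) ≤ T := by
  intro x hx
  have key : ∀ t ∈ T, x * t ∈ T := by
    refine Algebra.adjoin_induction (p := fun x _ => ∀ t ∈ T, x * t ∈ T) hs ?_ ?_ ?_ hx
    · intro r t ht
      rw [← Algebra.smul_def]
      exact T.smul_mem r ht
    · intro x y _ _ hx hy t ht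
      rw [add_mul]
      exact T.add_mem (hx t ht) (hy t ht)
    · intro x y _ _ hx hy t ht
      rw [mul_assoc]
      exact hx _ (hy t ht)
  simpa using key 1 h1

/-- An inner derivation that maps the generators of a subalgebra into it preserves it. -/
lemma commMap_mem_adjoin (s : Set A) (d : A)
    (h : ∀ g ∈ s, commMap d g ∈ Algebra.adjoin ℂ s) {x : A} (hx : x ∈ Algebra.adjoin ℂ s) :
    commMap d x ∈ Algebra.adjoin ℂ s := by
  induction hx using Algebra.adjoin_induction with
  | mem x hx => exact h x hx
  | algebraMap r =>
    rw [commMap_apply, Algebra.commutes, sub_self]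
    exact zero_mem _
  | add x y _ _ hx hy => rw [map_add]; exact add_mem hx hy
  | mul x y hx' hy' hx hy =>
    rw [commMap_mul]
    exact add_mem (mul_mem hx hy') (mul_mem hx' hy)

/-- Two inner derivations that agree on generators agree on the generated subalgebra. -/
lemma commMap_eq_of_adjoin (s : Set A) (d d' : A) (h : ∀ g ∈ s, commMap d g = commMap d' g)
    {x : A} (hx : x ∈ Algebra.adjoin ℂ s) : commMap d x = commMap d' x := by
  induction hx using Algebra.adjoin_induction with
  | mem x hx => exact h x hx
  | algebraMap r => simp [Algebra.commutes]
  | add x y _ _ hx hy => rw [map_add, map_add, hx, hy]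
  | mul x y _ _ hx hy => rw [commMap_mul, commMap_mul, hx, hy]

/-- The commutator of a product with an element that anticommutes with both factors up to
scalars. -/
lemma mul_commMap_of_anticomm {x y u : A} {s t : ℂ} (hy : y * u + u * y = s • 1)
    (hx : x * u + u * x = t • 1) : commMap (x * y) u = s • x - t • y := by
  have h1 : y * u = s • 1 - u * y := eq_sub_of_add_eq hy
  have h2 : x * u = t • 1 - u * x := eq_sub_of_add_eq hx
  calc commMap (x * y) u = x * (y * u) - u * (x * y) := by rw [commMap_apply, mul_assoc]
    _ = s • x - (x * u) * y - u * (x * y) := by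
      rw [h1, mul_sub, mul_smul_comm, mul_one, mul_assoc]
    _ = s • x - t • y := by
      rw [h2, sub_mul, smul_mul_assoc, one_mul, mul_assoc]; abel

end General

/-! ### Eigenspaces and dimensions of kernels -/

section Linear

variable {M : Type*} [AddCommGroup M] [Module ℂ M]

/-- A sum of subspaces of eigenspaces meets an eigenspace only in the summand it contains. -/
lemma mem_of_mem_iSup_of_mem_eigenspace (T : Module.End ℂ M) {ι : Type*} (μ : ι → ℂ)
    (hμ : Function.Injective μ) (G : ι → Submodule ℂ M) (hG : ∀ i, G i ≤ T.eigenspace (μ i))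
    {x : M} (hx : x ∈ ⨆ i, G i) {k : ι} (hk : x ∈ T.eigenspace (μ k)) : x ∈ G k := by
  have hle : (⨆ i, G i) ≤ G k ⊔ ⨆ (i) (_ : i ≠ k), G i := by
    refine iSup_le fun i => ?_
    by_cases h : i = k
    · subst h; exact le_sup_left
    · exact le_sup_of_le_right (le_iSup₂_of_le i h le_rfl)
  obtain ⟨y, hy, z, hz, rfl⟩ := Submodule.mem_sup.mp (hle hx)
  have hz' : z ∈ ⨆ (i) (_ : i ≠ k), T.eigenspace (μ i) :=
    (iSup₂_mono fun i _ => hG i) hz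
  have hzk : z ∈ T.eigenspace (μ k) := by
    simpa using sub_mem hk (hG k hy)
  have hind := (T.eigenspaces_iSupIndep.comp hμ) k
  have : z = 0 := by
    have := (Submodule.disjoint_def.mp hind) z hzk hz'
    exact this
  simpa [this] using hy

/-- `L` is a contracting homotopy for the differential `D` on `V`, so the complex is exact: kernel
and range of `D` coincide, and rank-nullity gives half the dimension. -/
lemma two_mul_finrank_inf_ker [FiniteDimensional ℂ M] (V : Submodule ℂ M) (D L : Module.End ℂ M)
    (hD : ∀ x ∈ V, D x ∈ V) (hL : ∀ x ∈ V, L x ∈ V) (hDD : ∀ x ∈ V, D (D x) = 0)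
    (hDL : ∀ x ∈ V, D (L x) + L (D x) = x) :
    2 * Module.finrank ℂ (V ⊓ LinearMap.ker D : Submodule ℂ M) = Module.finrank ℂ V := by
  set D' : Module.End ℂ V := D.restrict hD
  have hker : LinearMap.ker D' = LinearMap.range D' := by
    ext x
    constructor
    · intro hx
      have hx0 : D x = 0 := by simpa [D'] using congrArg Subtype.val (LinearMap.mem_ker.mp hx)
      refine ⟨⟨L x, hL x x.2⟩, Subtype.ext ?_⟩
      simpa [D', hx0] using hDL x x.2
    · rintro ⟨y, rfl⟩
      refine LinearMap.mem_ker.mpr (Subtype.ext ?_)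
      simpa [D'] using hDD y y.2
  have hmap : V ⊓ LinearMap.ker D = (LinearMap.ker D').map V.subtype := by
    ext x
    constructor
    · rintro ⟨hx, hx'⟩
      exact ⟨⟨x, hx⟩, LinearMap.mem_ker.mpr (Subtype.ext (by simpa [D'] using hx')), rfl⟩
    · rintro ⟨y, hy, rfl⟩
      refine ⟨y.2, ?_⟩
      simpa [D'] using congrArg Subtype.val (LinearMap.mem_ker.mp hy)
  rw [hmap, Submodule.finrank_map_subtype_eq]
  have := LinearMap.finrank_range_add_finrank_ker D'
  rw [← hker] at this
  omega

/-- An involution that anticommutes with another involution has eigenspaces of half the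
dimension. -/
lemma two_mul_finrank_inf_ker_involution [FiniteDimensional ℂ M] (V : Submodule ℂ M)
    (S α : Module.End ℂ M) (hS : ∀ x ∈ V, S x ∈ V) (hα : ∀ x ∈ V, α x ∈ V)
    (hSS : ∀ x ∈ V, S (S x) = x) (hαα : ∀ x ∈ V, α (α x) = x)
    (hαS : ∀ x ∈ V, α (S x) = -S (α x)) :
    2 * Module.finrank ℂ (V ⊓ LinearMap.ker (1 - α) : Submodule ℂ M) = Module.finrank ℂ V := by
  -- `S` exchanges the two eigenspaces of `α`. With `D = ½ S(1 - α)` and `L = ½ S(1 + α)` one gets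
  -- `D² = 0`, `DL = ½(1 + α)` and `LD = ½(1 - α)`.
  have h := two_mul_finrank_inf_ker V ((1 / 2 : ℂ) • (S ∘ₗ (1 - α)))
    ((1 / 2 : ℂ) • (S ∘ₗ (1 + α)))
    (fun x hx => V.smul_mem _ (hS _ (sub_mem hx (hα x hx))))
    (fun x hx => V.smul_mem _ (hS _ (add_mem hx (hα x hx))))
    (fun x hx => by
      simp only [LinearMap.smul_apply, LinearMap.comp_apply, LinearMap.sub_apply,
        Module.End.one_apply, map_smul, map_sub, hαS x hx, hαS _ (hα x hx), hαα x hx, hSS x hx,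
        hSS _ (hα x hx), map_neg]
      module)
    (fun x hx => by
      simp only [LinearMap.smul_apply, LinearMap.comp_apply, LinearMap.sub_apply,
        LinearMap.add_apply, Module.End.one_apply, map_smul, map_sub, map_add, hαS x hx,
        hαS _ (hα x hx), hαα x hx, hSS x hx, hSS _ (hα x hx), map_neg]
      module)
  have hker : V ⊓ LinearMap.ker (1 - α) = V ⊓ LinearMap.ker ((1 / 2 : ℂ) • (S ∘ₗ (1 - α))) := by
    ext x
    refine and_congr_right fun hx => ?_
    simp only [SetLike.mem_coe, LinearMap.mem_ker, LinearMap.smul_apply, LinearMap.comp_apply,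
      smul_eq_zero, one_div, inv_eq_zero, OfNat.ofNat_ne_zero, false_or]
    refine ⟨fun h => by rw [h, map_zero], fun h => ?_⟩
    have := congrArg S h
    rwa [hSS ((1 - α) x) (V.sub_mem hx (hα x hx)), map_zero] at this
  rw [hker, h]

/-! ## Weight vectors of `sl(2)` -/

/-- A family of weight spaces with the raising and lowering operators of `sl(2)`. -/
structure Sl2Weights (E F : Module.End ℂ M) (W : ℤ → Submodule ℂ M) : Prop where
  raise : ∀ m, ∀ v ∈ W m, E v ∈ W (m + 2)
  lower : ∀ m, ∀ v ∈ W m, F v ∈ W (m - 2)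
  comm : ∀ m, ∀ v ∈ W m, E (F v) - F (E v) = (m : ℂ) • v
  nilp : ∀ m, ∀ v ∈ W m, ∃ k : ℕ, (E ^ k) v = 0

namespace Sl2Weights

variable {E F : Module.End ℂ M} {W : ℤ → Submodule ℂ M}

lemma pow_mem (h : Sl2Weights E F W) {m : ℤ} {v : M} (hv : v ∈ W m) (k : ℕ) :
    (E ^ k) v ∈ W (m + 2 * k) := by
  induction k with
  | zero => simpa using hv
  | succ k ih =>
    rw [pow_succ', Module.End.mul_apply]
    have := h.raise _ _ ih
    convert this using 2
    push_cast; ring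

lemma pow_lower (h : Sl2Weights E F W) {m : ℤ} {v : M} (hv : v ∈ W m) (k : ℕ) :
    (E ^ (k + 1)) (F v) = F ((E ^ (k + 1)) v) + ((k + 1 : ℂ) * (m + k)) • (E ^ k) v := by
  induction k with
  | zero =>
    have := h.comm m v hv
    simp only [zero_add, pow_one, pow_zero, Module.End.one_apply, Nat.cast_zero, one_mul, add_zero]
    rw [← this]; abel
  | succ k ih =>
    rw [pow_succ' E (k + 1), Module.End.mul_apply, Module.End.mul_apply, ih, map_add, map_smul]
    have h1 := h.comm _ _ (h.pow_mem hv (k + 1))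
    have h2 : E ((E ^ k) v) = (E ^ (k + 1)) v := by rw [pow_succ', Module.End.mul_apply]
    rw [sub_eq_iff_eq_add.mp h1, h2]
    push_cast
    module

/-- Induction on the power of `E` that kills `v`. If `E^(k+1) v = 0`, then `pow_lower` gives `E^k (E
F v) = (k+1)(m+k) E^k v`, and the coefficient is nonzero because `m ≥ 1`. Subtracting the right
multiple of `E F v`, which is in the range of `E`, leaves a vector killed by `E^k`. -/
lemma exists_raise_eq (h : Sl2Weights E F W) {m : ℤ} (hm : 1 ≤ m) {v : M} (hv : v ∈ W m) :
    ∃ w ∈ W (m - 2), E w = v := by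
  obtain ⟨k, hk⟩ := h.nilp m v hv
  induction k generalizing v with
  | zero => exact ⟨0, zero_mem _, by simpa using hk.symm⟩
  | succ k ih =>
    have hne : ((k + 1 : ℂ) * (m + k)) ≠ 0 := by
      have h1 : ((k : ℤ) + 1) * (m + k) ≠ 0 := mul_ne_zero (by omega) (by omega)
      exact_mod_cast h1
    set c : ℂ := ((k + 1 : ℂ) * (m + k))⁻¹ with hc
    have hEF : E (F v) ∈ W m := by simpa using h.raise _ _ (h.lower m v hv)
    obtain ⟨w, hw, hwv⟩ := ih (v := v - c • E (F v)) (sub_mem hv (Submodule.smul_mem _ _ hEF)) (by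
      have h2 : (E ^ k) (E (F v)) = (E ^ (k + 1)) (F v) := by rw [pow_succ, Module.End.mul_apply]
      rw [map_sub, map_smul, h2, h.pow_lower hv, hk, map_zero, zero_add, smul_smul, hc,
        inv_mul_cancel₀ hne, one_smul, sub_self])
    exact ⟨w + c • F v, add_mem hw (Submodule.smul_mem _ _ (h.lower m v hv)), by simp [hwv]⟩

/-- Each weight met on the way down, `2n, …, 2`, is at least `1`, so one factor `E` can be stripped
off at a time. -/
lemma exists_pow_eq (h : Sl2Weights E F W) (n : ℕ) {v : M} (hv : v ∈ W (2 * n)) :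
    ∃ w ∈ W 0, (E ^ n) w = v := by
  induction n generalizing v with
  | zero => exact ⟨v, by simpa using hv, by simp⟩
  | succ n ih =>
    obtain ⟨w, hw, rfl⟩ := h.exists_raise_eq (by push_cast; omega) hv
    obtain ⟨u, hu, rfl⟩ := ih (v := w) (by convert hw using 2; push_cast; ring)
    exact ⟨u, hu, by rw [pow_succ', Module.End.mul_apply]⟩

end Sl2Weights

end Linear

/-! ## Lattice fermions -/

/-- Lattice fermions on the sites `0, …, n`, with the parity operator, that generate the
algebra `A`. -/
structure FermionSystem (n : ℕ) (A : Type*) [Ring A] [Algebra ℂ A] where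
  c : Fin (n + 1) → A
  cd : Fin (n + 1) → A
  P : A
  P_mul_P : P * P = 1
  P_c : ∀ j, P * c j = -(c j * P)
  P_cd : ∀ j, P * cd j = -(cd j * P)
  c_c : ∀ j k, c j * c k + c k * c j = 0
  cd_cd : ∀ j k, cd j * cd k + cd k * cd j = 0
  c_cd : ∀ j k, c j * cd k + cd k * c j = (if j = k then (1 : ℂ) else 0) • 1
  adjoin_eq_top : Algebra.adjoin ℂ (Set.range c ∪ Set.range cd) = ⊤

namespace FermionSystem

variable {n : ℕ} {A : Type*} [Ring A] [Algebra ℂ A] (F : FermionSystem n A)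

/-- The particle-hole transformation. -/
@[simps] def swap : FermionSystem n A where
  c := F.cd
  cd := F.c
  P := F.P
  P_mul_P := F.P_mul_P
  P_c := F.P_cd
  P_cd := F.P_c
  c_c := F.cd_cd
  cd_cd := F.c_c
  c_cd j k := by
    rw [add_comm, F.c_cd]
    simp only [eq_comm]
  adjoin_eq_top := by rw [Set.union_comm, F.adjoin_eq_top]

lemma P_mul_P_mul (x : A) : F.P * (F.P * x) = x := by
  rw [← mul_assoc, F.P_mul_P, one_mul]

lemma c_sq (j) : F.c j * F.c j = 0 := by
  have h := F.c_c j j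
  rw [← two_smul ℂ] at h
  exact (smul_eq_zero.mp h).resolve_left two_ne_zero

lemma cd_sq (j) : F.cd j * F.cd j = 0 := F.swap.c_sq j

/-! ### Zero modes and bond fermions -/

/-- The odd zero mode `∑ⱼ iʲ cⱼ`. -/
def psi : A := ∑ j : Fin (n + 1), I ^ pos j • F.c j

/-- The odd zero mode `∑ⱼ iʲ c†ⱼ`. -/
def psiDag : A := ∑ j : Fin (n + 1), I ^ pos j • F.cd j

/-- The bond fermion `aₖ = cₖ + i cₖ₊₁`. -/
def bond (k : Fin n) : A := F.c k.castSucc + I • F.c k.succ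

/-- The bond fermion `a†ₖ = c†ₖ + i c†ₖ₊₁`. -/
def bondDag (k : Fin n) : A := F.cd k.castSucc + I • F.cd k.succ

lemma swap_bond (k : Fin n) : F.swap.bond k = F.bondDag k := rfl
lemma swap_bondDag (k : Fin n) : F.swap.bondDag k = F.bond k := rfl

/-- The set of all bond fermions. -/
def bonds : Set A := Set.range F.bond ∪ Set.range F.bondDag

lemma swap_bonds : F.swap.bonds = F.bonds := Set.union_comm _ _

lemma bond_mem (k) : F.bond k ∈ F.bonds := Or.inl ⟨k, rfl⟩
lemma bondDag_mem (k) : F.bondDag k ∈ F.bonds := Or.inr ⟨k, rfl⟩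

/-- The anticommutator of the bond fermions on two bonds. -/
def overlap (k l : Fin n) : ℂ := if k.val + 1 = l.val ∨ l.val + 1 = k.val then I else 0

lemma overlap_comm (k l : Fin n) : overlap k l = overlap l k := by
  simp only [overlap, or_comm]

lemma I_zpow_succ (m : ℤ) : I ^ (m + 1) = I ^ m * I := zpow_add_one₀ Complex.I_ne_zero m

lemma pos_succ (k : Fin n) : pos k.succ = pos k.castSucc + 1 := by
  simp [pos]

lemma c_bond (j k) : F.c j * F.bond k + F.bond k * F.c j = 0 := by
  have h1 := F.c_c j k.castSucc
  have h2 := F.c_c j k.succ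
  calc _ = (F.c j * F.c k.castSucc + F.c k.castSucc * F.c j)
      + I • (F.c j * F.c k.succ + F.c k.succ * F.c j) := by
        simp only [bond, mul_add, add_mul, smul_mul_assoc, mul_smul_comm, smul_add]; abel
    _ = 0 := by rw [h1, h2, smul_zero, add_zero]

lemma cd_bond (j k) : F.cd j * F.bond k + F.bond k * F.cd j
    = ((if k.castSucc = j then (1 : ℂ) else 0) + I * (if k.succ = j then (1 : ℂ) else 0)) • 1 := by
  have h1 := F.c_cd k.castSucc j
  have h2 := F.c_cd k.succ j
  calc _ = (F.c k.castSucc * F.cd j + F.cd j * F.c k.castSucc)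
      + I • (F.c k.succ * F.cd j + F.cd j * F.c k.succ) := by
        simp only [bond, mul_add, add_mul, smul_mul_assoc, mul_smul_comm, smul_add]; abel
    _ = _ := by rw [h1, h2, add_smul, mul_smul]

lemma bond_bond (j k) : F.bond j * F.bond k + F.bond k * F.bond j = 0 := by
  have h1 := F.c_bond j.castSucc k
  have h2 := F.c_bond j.succ k
  calc _ = (F.c j.castSucc * F.bond k + F.bond k * F.c j.castSucc)
      + I • (F.c j.succ * F.bond k + F.bond k * F.c j.succ) := by
        rw [bond.eq_1 F j]
        simp only [mul_add, add_mul, smul_mul_assoc, mul_smul_comm, smul_add]; abel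
    _ = 0 := by rw [h1, h2, smul_zero, add_zero]

lemma bondDag_bondDag (j k) : F.bondDag j * F.bondDag k + F.bondDag k * F.bondDag j = 0 :=
  F.swap.bond_bond j k

lemma bondDag_bond (j k) : F.bondDag j * F.bond k + F.bond k * F.bondDag j
    = overlap j k • 1 := by
  have h1 := F.cd_bond j.castSucc k
  have h2 := F.cd_bond j.succ k
  calc _ = (F.cd j.castSucc * F.bond k + F.bond k * F.cd j.castSucc)
      + I • (F.cd j.succ * F.bond k + F.bond k * F.cd j.succ) := by
        rw [bondDag.eq_1 F j]
        simp only [mul_add, add_mul, smul_mul_assoc, mul_smul_comm, smul_add]; abel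
    _ = _ := by
      rw [h1, h2, smul_smul, ← add_smul]
      congr 1
      simp only [overlap, Fin.ext_iff, Fin.val_castSucc, Fin.val_succ]
      rcases lt_trichotomy j.val k.val with h | h | h
      · by_cases h' : j.val + 1 = k.val
        · have e1 : k.val ≠ j.val := by omega
          have e2 : k.val + 1 ≠ j.val := by omega
          simp [h', e1, e2]
        · have e1 : k.val ≠ j.val := by omega
          have e2 : k.val + 1 ≠ j.val := by omega
          have e3 : k.val ≠ j.val + 1 := by omega
          simp [h', e1, e2, e3]
      · simp [h]
      · by_cases h' : k.val + 1 = j.val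
        · have e1 : k.val ≠ j.val := by omega
          have e2 : k.val ≠ j.val + 1 := by omega
          simp [h', e1, e2]
        · have e1 : k.val ≠ j.val := by omega
          have e2 : j.val + 1 ≠ k.val := by omega
          have e3 : k.val ≠ j.val + 1 := by omega
          simp [h', e1, e2, e3]

lemma bond_bondDag (j k) : F.bond j * F.bondDag k + F.bondDag k * F.bond j
    = overlap j k • 1 := F.swap.bondDag_bond j k

lemma psi_anti (x : A) (s : Fin (n + 1) → ℂ) (h : ∀ j, F.c j * x + x * F.c j = s j • 1) :
    F.psi * x + x * F.psi = (∑ j, I ^ pos j * s j) • 1 := by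
  simp only [psi, Finset.sum_mul, Finset.mul_sum, smul_mul_assoc, mul_smul_comm,
    ← Finset.sum_add_distrib, ← smul_add, h, smul_smul, ← Finset.sum_smul]

lemma psi_c (j) : F.psi * F.c j + F.c j * F.psi = 0 := by
  rw [F.psi_anti (F.c j) (fun _ => 0) (fun k => by rw [F.c_c, zero_smul])]; simp

lemma psi_cd (j) : F.psi * F.cd j + F.cd j * F.psi = I ^ pos j • 1 := by
  rw [F.psi_anti (F.cd j) _ (fun k => F.c_cd k j)]; simp

lemma psi_bond (k) : F.psi * F.bond k + F.bond k * F.psi = 0 := by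
  rw [F.psi_anti (F.bond k) (fun _ => 0) (fun j => by rw [F.c_bond, zero_smul])]; simp

/-- The two sites of the bond contribute `iᵏ` and `i · iᵏ⁺¹ = -iᵏ`. This cancellation dictates the
coefficient `i` in the bond fermions. -/
lemma psi_bondDag (k) : F.psi * F.bondDag k + F.bondDag k * F.psi = 0 := by
  rw [F.psi_anti (F.bondDag k) _ (fun j => F.swap.cd_bond j k)]
  have : ∑ j : Fin (n + 1), I ^ pos j * ((if k.castSucc = j then (1 : ℂ) else 0)
      + I * (if k.succ = j then (1 : ℂ) else 0)) = 0 := by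
    simp only [mul_add, Finset.sum_add_distrib, mul_ite, mul_one, mul_zero, Finset.sum_ite_eq,
      Finset.mem_univ, if_true]
    rw [pos_succ, I_zpow_succ, mul_assoc, Complex.I_mul_I]
    ring
  rw [this, zero_smul]

lemma psi_of_mem_bonds {u : A} (hu : u ∈ F.bonds) : F.psi * u + u * F.psi = 0 := by
  rcases hu with ⟨k, rfl⟩ | ⟨k, rfl⟩
  · exact F.psi_bond k
  · exact F.psi_bondDag k

lemma psiDag_of_mem_bonds {u : A} (hu : u ∈ F.bonds) : F.psiDag * u + u * F.psiDag = 0 :=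
  F.swap.psi_of_mem_bonds (by rwa [swap_bonds])

lemma P_psi : F.P * F.psi = -(F.psi * F.P) := by
  simp only [psi, Finset.mul_sum, Finset.sum_mul, mul_smul_comm, smul_mul_assoc, F.P_c, smul_neg,
    Finset.sum_neg_distrib]

lemma P_psiDag : F.P * F.psiDag = -(F.psiDag * F.P) := F.swap.P_psi

lemma P_bond (k) : F.P * F.bond k = -(F.bond k * F.P) := by
  simp only [bond, mul_add, add_mul, mul_smul_comm, smul_mul_assoc, F.P_c, smul_neg, neg_add]

lemma P_bondDag (k) : F.P * F.bondDag k = -(F.bondDag k * F.P) := F.swap.P_bond k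

lemma P_of_mem_bonds {u : A} (hu : u ∈ F.bonds) : F.P * u = -(u * F.P) := by
  rcases hu with ⟨k, rfl⟩ | ⟨k, rfl⟩
  · exact F.P_bond k
  · exact F.P_bondDag k

/-- Every bond fermion anticommutes with `cⱼ` up to a scalar. -/
lemma exists_c_of_mem_bonds {u : A} (hu : u ∈ F.bonds) (j) :
    ∃ s : ℂ, u * F.c j + F.c j * u = s • 1 := by
  rcases hu with ⟨k, rfl⟩ | ⟨k, rfl⟩
  · exact ⟨0, by rw [add_comm, F.c_bond, zero_smul]⟩
  · exact ⟨_, by rw [add_comm]; exact F.swap.cd_bond j k⟩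

lemma exists_cd_of_mem_bonds {u : A} (hu : u ∈ F.bonds) (j) :
    ∃ s : ℂ, u * F.cd j + F.cd j * u = s • 1 :=
  F.swap.exists_c_of_mem_bonds (by rwa [swap_bonds]) j

/-! ### Odd superderivations -/

/-- The supercommutator with an odd element `v`. -/
def superMap (v : A) : Module.End ℂ A :=
  LinearMap.mulLeft ℂ v - LinearMap.mulLeft ℂ F.P ∘ₗ LinearMap.mulRight ℂ (F.P * v)

lemma superMap_apply (v x : A) : F.superMap v x = v * x - F.P * x * F.P * v := by
  simp [superMap, mul_assoc]

lemma superMap_of_odd {v x : A} (hx : F.P * x = -(x * F.P)) :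
    F.superMap v x = v * x + x * v := by
  rw [superMap_apply, hx]
  simp only [neg_mul, mul_assoc, F.P_mul_P_mul, sub_neg_eq_add]

lemma superMap_of_even {v x : A} (hx : F.P * x = x * F.P) :
    F.superMap v x = v * x - x * v := by
  rw [superMap_apply, hx, mul_assoc x, F.P_mul_P, mul_one]

/-- The supercommutator is an odd superderivation. -/
lemma superMap_mul (v x y : A) :
    F.superMap v (x * y) = F.superMap v x * y + F.P * x * F.P * F.superMap v y := by
  simp only [superMap_apply, mul_sub, sub_mul]
  have : F.P * x * F.P * (F.P * y * F.P * v) = F.P * (x * y) * F.P * v := by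
    calc _ = F.P * x * (F.P * F.P) * y * F.P * v := by simp only [mul_assoc]
      _ = _ := by rw [F.P_mul_P]; simp only [mul_assoc, mul_one]
  rw [this]
  simp only [mul_assoc]
  abel

/-- Multiplication by an odd element and the supercommutator satisfy a Clifford relation. -/
lemma superMap_mul_odd {v w : A} (hw : F.P * w = -(w * F.P)) (x : A) :
    F.superMap v (w * x) + w * F.superMap v x = (v * w + w * v) * x := by
  rw [superMap_mul, F.superMap_of_odd hw, hw]
  have : -(w * F.P) * F.P = -w := by rw [neg_mul, mul_assoc, F.P_mul_P, mul_one]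
  rw [this, neg_mul, neg_add_cancel_right]

/-- By the super Jacobi identity the anticommutator of two odd superderivations is the commutator
with `v w + w v`, which vanishes since that element is a scalar. -/
lemma superMap_superMap {v w : A} (hv : F.P * v = -(v * F.P)) (hw : F.P * w = -(w * F.P))
    {s : ℂ} (h : v * w + w * v = s • 1) (x : A) :
    F.superMap v (F.superMap w x) + F.superMap w (F.superMap v x) = 0 := by
  have key : ∀ w v : A, F.P * w = -(w * F.P) → F.superMap v (F.superMap w x)
      = v * w * x - v * (F.P * x * F.P) * w + w * (F.P * x * F.P) * v - x * w * v := by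
    intro w v hw
    have h1 : F.P * (w * x) * F.P * v = -(w * (F.P * x * F.P) * v) := by
      rw [← mul_assoc F.P, hw]; simp only [neg_mul, mul_assoc]
    have h2 : F.P * (F.P * x * F.P * w) * F.P * v = - (x * w * v) := by
      calc _ = (F.P * F.P) * x * (F.P * w) * F.P * v := by simp only [mul_assoc]
        _ = - (x * w * (F.P * F.P) * v) := by
          rw [hw, F.P_mul_P, one_mul, mul_one]
          simp only [neg_mul, mul_neg, mul_assoc, F.P_mul_P_mul]
        _ = _ := by rw [F.P_mul_P, mul_one]
    rw [superMap_apply, superMap_apply, mul_sub, mul_sub, sub_mul, sub_mul, h1, h2]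
    simp only [mul_assoc]
    abel
  rw [key w v hw, key v w hv]
  have h3 : (v * w + w * v) * x = x * (v * w + w * v) := by rw [h]; simp
  simp only [add_mul, mul_add] at h3
  calc _ = (v * w * x + w * v * x) - (x * (v * w) + x * (w * v)) := by
        simp only [mul_assoc]; abel
    _ = 0 := by rw [h3, sub_self]

lemma superMap_sq {v : A} (hv : F.P * v = -(v * F.P)) (h : v * v = 0) (x : A) :
    F.superMap v (F.superMap v x) = 0 := by
  have := F.superMap_superMap hv hv (s := 0) (by simp [h]) x
  rw [← two_smul ℂ] at this
  exact (smul_eq_zero.mp this).resolve_left two_ne_zero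

lemma superMap_eq_zero_of_mem_adjoin {v : A} {s : Set A}
    (hodd : ∀ u ∈ s, F.P * u = -(u * F.P)) (h : ∀ u ∈ s, v * u + u * v = 0) {x : A}
    (hx : x ∈ Algebra.adjoin ℂ s) : F.superMap v x = 0 := by
  induction hx using Algebra.adjoin_induction with
  | mem x hx => rw [F.superMap_of_odd (hodd x hx), h x hx]
  | algebraMap r =>
    rw [F.superMap_of_even (Algebra.commutes r F.P).symm, Algebra.commutes, sub_self]
  | add x y _ _ hx hy => rw [map_add, hx, hy, add_zero]
  | mul x y _ _ hx hy => rw [superMap_mul, hx, hy, zero_mul, mul_zero, add_zero]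

/-! ### The bond algebra and the commutant of the zero modes -/

/-- The algebra generated by the bond fermions. -/
def bondAlg : Subalgebra ℂ A := Algebra.adjoin ℂ F.bonds

/-- The algebra generated by the products of two bond fermions. -/
def quad : Subalgebra ℂ A := Algebra.adjoin ℂ {x | ∃ u ∈ F.bonds, ∃ v ∈ F.bonds, x = u * v}

lemma mul_mem_quad {u v : A} (hu : u ∈ F.bonds) (hv : v ∈ F.bonds) : u * v ∈ F.quad :=
  Algebra.subset_adjoin ⟨u, hu, v, hv, rfl⟩

lemma bonds_subset_bondAlg {u : A} (hu : u ∈ F.bonds) : u ∈ F.bondAlg :=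
  Algebra.subset_adjoin hu

lemma superMap_psi_of_mem {x : A} (hx : x ∈ F.bondAlg) : F.superMap F.psi x = 0 :=
  F.superMap_eq_zero_of_mem_adjoin (fun _ => F.P_of_mem_bonds) (fun _ => F.psi_of_mem_bonds) hx

lemma superMap_psiDag_of_mem {x : A} (hx : x ∈ F.bondAlg) : F.superMap F.psiDag x = 0 :=
  F.superMap_eq_zero_of_mem_adjoin (fun _ => F.P_of_mem_bonds) (fun _ => F.psiDag_of_mem_bonds) hx

lemma c_mem_of_bonds (S : Subalgebra ℂ A) (h0 : F.c 0 ∈ S) (h : ∀ u ∈ F.bonds, u ∈ S) (j) :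
    F.c j ∈ S := by
  induction j using Fin.induction with
  | zero => exact h0
  | succ k ih =>
    have h1 : F.c k.succ = (-I) • (F.bond k - F.c k.castSucc) := by
      rw [bond, add_sub_cancel_left, smul_smul]; simp
    rw [h1]
    exact S.smul_mem (sub_mem (h _ (F.bond_mem k)) ih) _

lemma adjoin_bonds_eq_top : Algebra.adjoin ℂ ({F.c 0, F.cd 0} ∪ F.bonds) = ⊤ := by
  rw [eq_top_iff, ← F.adjoin_eq_top]
  refine Algebra.adjoin_le ?_
  rintro _ (⟨j, rfl⟩ | ⟨j, rfl⟩)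
  · exact F.c_mem_of_bonds _ (Algebra.subset_adjoin (Or.inl (by simp)))
      (fun u hu => Algebra.subset_adjoin (Or.inr hu)) j
  · exact F.swap.c_mem_of_bonds _ (Algebra.subset_adjoin (Or.inl (by simp)))
      (fun u hu => Algebra.subset_adjoin (Or.inr (by rwa [← F.swap_bonds]))) j

/-- Normal ordering: a bond fermion passes `c₀` and `c†₀` up to a sign and a scalar, and `c₀, c†₀`
satisfy the one-mode relations among themselves. So the expressions of this form are stable under
left multiplication by all generators. Uniqueness of the coefficients is not needed. -/
lemma exists_decomp (x : A) : ∃ u₀ ∈ F.bondAlg, ∃ u₁ ∈ F.bondAlg, ∃ u₂ ∈ F.bondAlg,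
    ∃ u₃ ∈ F.bondAlg, x = u₀ + F.c 0 * u₁ + F.cd 0 * u₂ + F.c 0 * (F.cd 0 * u₃) := by
  let T : Submodule ℂ A :=
    { carrier := {x | ∃ u₀ ∈ F.bondAlg, ∃ u₁ ∈ F.bondAlg, ∃ u₂ ∈ F.bondAlg,
        ∃ u₃ ∈ F.bondAlg, x = u₀ + F.c 0 * u₁ + F.cd 0 * u₂ + F.c 0 * (F.cd 0 * u₃)}
      zero_mem' := ⟨0, zero_mem _, 0, zero_mem _, 0, zero_mem _, 0, zero_mem _, by simp⟩
      add_mem' := by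
        rintro _ _ ⟨u₀, h₀, u₁, h₁, u₂, h₂, u₃, h₃, rfl⟩ ⟨v₀, k₀, v₁, k₁, v₂, k₂, v₃, k₃, rfl⟩
        refine ⟨_, add_mem h₀ k₀, _, add_mem h₁ k₁, _, add_mem h₂ k₂, _, add_mem h₃ k₃, ?_⟩
        simp only [mul_add]; abel
      smul_mem' := by
        rintro r _ ⟨u₀, h₀, u₁, h₁, u₂, h₂, u₃, h₃, rfl⟩
        refine ⟨_, F.bondAlg.smul_mem h₀ r, _, F.bondAlg.smul_mem h₁ r, _,
          F.bondAlg.smul_mem h₂ r, _, F.bondAlg.smul_mem h₃ r, ?_⟩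
        simp only [mul_smul_comm, smul_add] }
  suffices h : (⊤ : Submodule ℂ A) ≤ T from h (x := x) trivial
  rw [← Algebra.top_toSubmodule, ← F.adjoin_bonds_eq_top]
  refine adjoin_le_of_mul_mem _ T
    ⟨1, one_mem _, 0, zero_mem _, 0, zero_mem _, 0, zero_mem _, by simp⟩ ?_
  rintro g hg _ ⟨u₀, h₀, u₁, h₁, u₂, h₂, u₃, h₃, rfl⟩
  have hcc : ∀ y, F.c 0 * (F.c 0 * y) = 0 := fun y => by rw [← mul_assoc, F.c_sq, zero_mul]
  have hdd : ∀ y, F.cd 0 * (F.cd 0 * y) = 0 := fun y => by rw [← mul_assoc, F.cd_sq, zero_mul]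
  have hdc : ∀ y, F.cd 0 * (F.c 0 * y) = y - F.c 0 * (F.cd 0 * y) := fun y => by
    have h := F.c_cd 0 0
    rw [if_pos rfl, one_smul] at h
    rw [← mul_assoc, eq_sub_of_add_eq' h, sub_mul, one_mul, mul_assoc]
  rcases hg with (rfl | rfl) | hg
  · refine ⟨0, zero_mem _, u₀, h₀, 0, zero_mem _, u₂, h₂, ?_⟩
    simp only [mul_add, hcc, mul_zero]; abel
  · refine ⟨u₁, h₁, 0, zero_mem _, u₀ + u₃, add_mem h₀ h₃, -u₁, neg_mem h₁, ?_⟩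
    simp only [mul_add, hdc, hdd, mul_zero, mul_neg]; abel
  · obtain ⟨s, hs⟩ := F.exists_c_of_mem_bonds hg 0
    obtain ⟨t, ht⟩ := F.exists_cd_of_mem_bonds hg 0
    have hg' := F.bonds_subset_bondAlg hg
    have hs' : ∀ y, g * (F.c 0 * y) = s • y - F.c 0 * (g * y) := fun y => by
      rw [← mul_assoc, eq_sub_of_add_eq hs, sub_mul, smul_mul_assoc, one_mul, mul_assoc]
    have ht' : ∀ y, g * (F.cd 0 * y) = t • y - F.cd 0 * (g * y) := fun y => by
      rw [← mul_assoc, eq_sub_of_add_eq ht, sub_mul, smul_mul_assoc, one_mul, mul_assoc]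
    refine ⟨g * u₀ + s • u₁ + t • u₂, add_mem (add_mem (mul_mem hg' h₀) (Subalgebra.smul_mem _ h₁ s))
      (Subalgebra.smul_mem _ h₂ t), -(g * u₁) - t • u₃,
      sub_mem (neg_mem (mul_mem hg' h₁)) (Subalgebra.smul_mem _ h₃ t), -(g * u₂) + s • u₃,
      add_mem (neg_mem (mul_mem hg' h₂)) (Subalgebra.smul_mem _ h₃ s), g * u₃, mul_mem hg' h₃, ?_⟩
    simp only [mul_add, hs', ht', mul_sub, mul_neg, mul_smul_comm]
    abel

/-- The supercommutators annihilate the coefficients of the normal form; that of `ψ` differentiates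
`c†₀` and ignores `c₀`, that of `ψ†` does the opposite. The coefficients `u₃`, `u₁`, `u₂` therefore
vanish in turn. -/
lemma mem_bondAlg_of_superMap {x : A} (h : F.superMap F.psi x = 0)
    (h' : F.superMap F.psiDag x = 0) : x ∈ F.bondAlg := by
  obtain ⟨u₀, h₀, u₁, h₁, u₂, h₂, u₃, h₃, rfl⟩ := F.exists_decomp x
  set z : ℂ := I ^ pos (0 : Fin (n + 1)) with hz
  have hz0 : z ≠ 0 := zpow_ne_zero _ Complex.I_ne_zero
  have e1 : ∀ y, F.superMap F.psi (F.c 0 * y) = -(F.c 0 * F.superMap F.psi y) := fun y => by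
    rw [eq_neg_iff_add_eq_zero, F.superMap_mul_odd (F.P_c 0), F.psi_c, zero_mul]
  have e2 : ∀ y, F.superMap F.psi (F.cd 0 * y) = z • y - F.cd 0 * F.superMap F.psi y := fun y => by
    rw [eq_sub_iff_add_eq, F.superMap_mul_odd (F.P_cd 0), F.psi_cd, smul_mul_assoc, one_mul]
  have e3 : ∀ y, F.superMap F.psiDag (F.cd 0 * y) = -(F.cd 0 * F.superMap F.psiDag y) := fun y => by
    rw [eq_neg_iff_add_eq_zero, F.superMap_mul_odd (F.P_cd 0)]
    exact (congrArg (· * y) (F.swap.psi_c 0)).trans (zero_mul y)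
  have e4 : ∀ y, F.superMap F.psiDag (F.c 0 * y) = z • y - F.c 0 * F.superMap F.psiDag y :=
    fun y => by
      rw [eq_sub_iff_add_eq, F.superMap_mul_odd (F.P_c 0)]
      exact (congrArg (· * y) (F.swap.psi_cd 0)).trans (by rw [smul_mul_assoc, one_mul])
  have a0 := fun {y} => F.superMap_psi_of_mem (x := y)
  have b0 := fun {y} => F.superMap_psiDag_of_mem (x := y)
  have k1 : z • u₁ + z • (F.cd 0 * u₃) = 0 := by
    simpa [e3, e4, b0 h₀, b0 h₁, b0 h₂, b0 h₃] using h'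
  -- The mixed second derivative isolates the top coefficient.
  have k2 : z • z • u₃ = 0 := by
    have := congrArg (F.superMap F.psi) k1
    simpa [e2, a0 h₁, a0 h₃] using this
  have hu₃ : u₃ = 0 := by simpa [hz0] using k2
  subst hu₃
  have hu₁ : u₁ = 0 := by simpa [hz0] using k1
  subst hu₁
  have hu₂ : u₂ = 0 := by simpa [e2, a0 h₀, a0 h₂, hz0] using h
  simpa [hu₂] using h₀

lemma even_of_mem_quad {x : A} (hx : x ∈ F.quad) : F.P * x = x * F.P := by
  have : F.quad ≤ Subalgebra.centralizer ℂ {F.P} := by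
    refine Algebra.adjoin_le ?_
    rintro _ ⟨u, hu, v, hv, rfl⟩
    simp only [SetLike.mem_coe, Subalgebra.mem_centralizer_iff, Set.mem_singleton_iff, forall_eq]
    rw [← mul_assoc, F.P_of_mem_bonds hu, neg_mul, mul_assoc, F.P_of_mem_bonds hv, mul_neg, neg_neg,
      mul_assoc]
  simpa [Subalgebra.mem_centralizer_iff] using this hx

lemma quad_le_bondAlg : F.quad ≤ F.bondAlg := by
  refine Algebra.adjoin_le ?_
  rintro _ ⟨u, hu, v, hv, rfl⟩
  exact mul_mem (F.bonds_subset_bondAlg hu) (F.bonds_subset_bondAlg hv)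

/-- The even part of the algebra generated by the bond fermions is generated by the products of
two bond fermions. -/
lemma mem_quad_of_even {x : A} (hx : x ∈ F.bondAlg) (hP : F.P * x = x * F.P) : x ∈ F.quad := by
  set O : Submodule ℂ A := Submodule.span ℂ F.bonds * Subalgebra.toSubmodule F.quad with hO
  -- The bond algebra is `quad` plus one bond fermion times `quad`; the first summand is even and
  -- the second odd, so evenness removes the second.
  have hle : Subalgebra.toSubmodule F.bondAlg ≤ Subalgebra.toSubmodule F.quad ⊔ O := by
    refine adjoin_le_of_mul_mem _ _ (Submodule.mem_sup_left (one_mem F.quad)) ?_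
    intro g hg t ht
    obtain ⟨y, hy, z, hz, rfl⟩ := Submodule.mem_sup.mp ht
    rw [mul_add]
    refine add_mem (Submodule.mem_sup_right
      (Submodule.mul_mem_mul (Submodule.subset_span hg) hy)) (Submodule.mem_sup_left ?_)
    have : O ≤ (Subalgebra.toSubmodule F.quad).comap (LinearMap.mulLeft ℂ g) := by
      rw [hO, Submodule.mul_le]
      intro u hu w hw
      simp only [Submodule.mem_comap, LinearMap.mulLeft_apply, ← mul_assoc]
      refine F.quad.mul_mem ?_ hw
      have : Submodule.span ℂ F.bonds
          ≤ (Subalgebra.toSubmodule F.quad).comap (LinearMap.mulLeft ℂ g) :=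
        Submodule.span_le.mpr fun v hv => F.mul_mem_quad hg hv
      exact this hu
    exact this hz
  obtain ⟨y, hy, z, hz, rfl⟩ := Submodule.mem_sup.mp (hle hx)
  have hodd : O ≤ LinearMap.ker (LinearMap.mulLeft ℂ F.P + LinearMap.mulRight ℂ F.P) := by
    rw [hO, Submodule.mul_le]
    intro u hu w hw
    have : Submodule.span ℂ F.bonds
        ≤ LinearMap.ker (LinearMap.mulLeft ℂ F.P + LinearMap.mulRight ℂ F.P) :=
      Submodule.span_le.mpr fun v hv => by simp [F.P_of_mem_bonds hv]
    have hu' : F.P * u = -(u * F.P) := by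
      simpa [add_eq_zero_iff_eq_neg] using this hu
    simp only [LinearMap.mem_ker, LinearMap.add_apply, LinearMap.mulLeft_apply,
      LinearMap.mulRight_apply]
    rw [← mul_assoc, hu', mul_assoc u, ← F.even_of_mem_quad hw, neg_mul, mul_assoc,
      neg_add_cancel]
  have hz1 : F.P * z + z * F.P = 0 := by simpa using hodd hz
  have hz2 : F.P * z = z * F.P := by
    rw [mul_add, add_mul, F.even_of_mem_quad hy] at hP
    exact add_left_cancel hP
  -- `z` both commutes and anticommutes with the invertible `P`.
  have hz3 : F.P * z = 0 := by
    rw [← hz2, ← two_smul ℂ] at hz1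
    exact (smul_eq_zero.mp hz1).resolve_left two_ne_zero
  have : z = 0 := by rw [← F.P_mul_P_mul z, hz3, mul_zero]
  rw [this, add_zero]
  exact hy

lemma superMap_eq_zero_of_commute {v x : A} (hP : F.P * x = x * F.P) :
    F.superMap v x = 0 ↔ v * x = x * v := by
  rw [F.superMap_of_even hP, sub_eq_zero]

/-- On even elements the supercommutator is the ordinary commutator, so the commutant is the even
part of the joint kernel of the two supercommutators. -/
theorem quad_eq_centralizer :
    F.quad = Subalgebra.centralizer ℂ {F.P, F.psi, F.psiDag} := by
  ext x
  simp only [Subalgebra.mem_centralizer_iff, Set.mem_insert_iff, Set.mem_singleton_iff,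
    forall_eq_or_imp, forall_eq]
  constructor
  · intro hx
    have hP := F.even_of_mem_quad hx
    exact ⟨hP, (F.superMap_eq_zero_of_commute hP).mp (F.superMap_psi_of_mem (F.quad_le_bondAlg hx)),
      (F.superMap_eq_zero_of_commute hP).mp (F.superMap_psiDag_of_mem (F.quad_le_bondAlg hx))⟩
  · rintro ⟨hP, h, h'⟩
    exact F.mem_quad_of_even (F.mem_bondAlg_of_superMap
      ((F.superMap_eq_zero_of_commute hP).mpr h) ((F.superMap_eq_zero_of_commute hP).mpr h')) hP

/-! ### The dimension -/

/-- Conjugation by the parity operator. -/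
def parity : Module.End ℂ A := LinearMap.mulLeft ℂ F.P ∘ₗ LinearMap.mulRight ℂ F.P

lemma parity_apply (x : A) : F.parity x = F.P * (x * F.P) := rfl

lemma parity_parity (x : A) : F.parity (F.parity x) = x := by
  simp only [parity_apply, mul_assoc, F.P_mul_P, mul_one, F.P_mul_P_mul]

lemma parity_mul_odd {w : A} (hw : F.P * w = -(w * F.P)) (x : A) :
    F.parity (w * x) = -(w * F.parity x) := by
  simp only [parity_apply, ← mul_assoc, hw, neg_mul]

lemma parity_superMap {v : A} (hv : F.P * v = -(v * F.P)) (x : A) :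
    F.parity (F.superMap v x) = -F.superMap v (F.parity x) := by
  have h1 : ∀ y, F.superMap v y = v * y - F.parity y * v := fun y => by
    rw [superMap_apply, parity_apply, mul_assoc F.P]
  have h2 : F.parity (F.parity x * v) = -(x * v) := by
    have h3 : v * F.P = -(F.P * v) := by rw [hv, neg_neg]
    rw [parity_apply, parity_apply]
    simp only [mul_assoc, h3, mul_neg, F.P_mul_P_mul]
  rw [h1, map_sub, F.parity_mul_odd hv, h2, h1, F.parity_parity]
  abel

/-- The Clifford relation makes left multiplication by `z⁻¹ w` a contracting homotopy for the
supercommutator with `v`. -/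
lemma two_mul_finrank_inf_ker_superMap [FiniteDimensional ℂ A] (V : Submodule ℂ A) {v w : A}
    {z : ℂ} (hz : z ≠ 0) (hv : F.P * v = -(v * F.P)) (hvv : v * v = 0)
    (hw : F.P * w = -(w * F.P)) (hvw : v * w + w * v = z • 1)
    (hD : ∀ x ∈ V, F.superMap v x ∈ V) (hL : ∀ x ∈ V, w * x ∈ V) :
    2 * Module.finrank ℂ (V ⊓ LinearMap.ker (F.superMap v) : Submodule ℂ A)
      = Module.finrank ℂ V := by
  refine two_mul_finrank_inf_ker V (F.superMap v) (z⁻¹ • LinearMap.mulLeft ℂ w) hD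
    (fun x hx => V.smul_mem _ (hL x hx)) (fun x _ => F.superMap_sq hv hvv x) (fun x _ => ?_)
  have := F.superMap_mul_odd (v := v) hw x
  rw [hvw, smul_mul_assoc, one_mul] at this
  rw [LinearMap.smul_apply, LinearMap.smul_apply, map_smul, ← smul_add]
  exact (congrArg _ this).trans (inv_smul_smul₀ hz x)

lemma psi_sq : F.psi * F.psi = 0 := by
  have := F.psi_anti F.psi (fun _ => 0) (fun j => by rw [add_comm, F.psi_c, zero_smul])
  rw [← two_smul ℂ] at this
  simpa using this

lemma exists_psi_psiDag : ∃ s : ℂ, F.psi * F.psiDag + F.psiDag * F.psi = s • 1 :=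
  ⟨_, F.psi_anti F.psiDag _ (fun j => by rw [add_comm]; exact F.swap.psi_cd j)⟩

/-- Three successive halvings: the kernel for `ψ`, inside it the kernel for `ψ†`, and finally the
even part. The last one needs a bond, hence `n ≥ 1`; on a single site `quad` consists of scalars. -/
theorem finrank_quad [FiniteDimensional ℂ A] (hn : 1 ≤ n) :
    8 * Module.finrank ℂ F.quad = Module.finrank ℂ A := by
  obtain ⟨b⟩ : Nonempty (Fin n) := ⟨⟨0, hn⟩⟩
  have hz : I ^ pos (0 : Fin (n + 1)) ≠ 0 := zpow_ne_zero _ Complex.I_ne_zero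
  have step1 := F.two_mul_finrank_inf_ker_superMap ⊤ hz F.P_psi F.psi_sq (F.P_cd 0) (F.psi_cd 0)
    (fun _ _ => trivial) (fun _ _ => trivial)
  set V : Submodule ℂ A := ⊤ ⊓ LinearMap.ker (F.superMap F.psi) with hV
  have memV : ∀ x, x ∈ V ↔ F.superMap F.psi x = 0 := fun x => by simp [hV]
  obtain ⟨s, hs⟩ := F.exists_psi_psiDag
  -- `c₀` is the homotopy here because it anticommutes with `ψ` and so preserves the first kernel.
  have step2 := F.two_mul_finrank_inf_ker_superMap V hz F.P_psiDag F.swap.psi_sq (F.P_c 0)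
    (F.swap.psi_cd 0)
    (fun x hx => by
      rw [memV] at hx ⊢
      have := F.superMap_superMap F.P_psi F.P_psiDag hs x
      rwa [hx, map_zero, add_zero] at this)
    (fun x hx => by
      rw [memV] at hx ⊢
      have := F.superMap_mul_odd (v := F.psi) (F.P_c 0) x
      rwa [hx, mul_zero, add_zero, F.psi_c, zero_mul] at this)
  set U : Submodule ℂ A := V ⊓ LinearMap.ker (F.superMap F.psiDag) with hU
  have memU : ∀ x, x ∈ U ↔ F.superMap F.psi x = 0 ∧ F.superMap F.psiDag x = 0 := fun x => by
    simp [hU, memV]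
  -- The odd involution exchanging even and odd parts of `U` is `x ↦ [v, x} + w x`. Its square is `v
  -- w + w v = 1`. The factor `w` has to be a bond fermion so that multiplication preserves `U`; for
  -- `v` it is enough that its anticommutators with `ψ` and `ψ†` are scalars. A site fermion works
  -- for `v` even when there is only one bond, where `a` and `a†` anticommute.
  set v := F.c b.castSucc with hv
  set w := F.bondDag b with hw
  have hvw : v * w + w * v = 1 := by
    have := F.swap.cd_bond b.castSucc b
    simpa [Fin.ext_iff, swap_bond] using this
  have hvo : F.P * v = -(v * F.P) := F.P_c _
  have hwo : F.P * w = -(w * F.P) := F.P_bondDag b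
  have hww : w * w = 0 := by
    have := F.bondDag_bondDag b b
    rw [← two_smul ℂ] at this
    exact (smul_eq_zero.mp this).resolve_left two_ne_zero
  obtain ⟨t, ht⟩ : ∃ t : ℂ, F.psiDag * v + v * F.psiDag = t • 1 := ⟨_, F.swap.psi_cd _⟩
  have step3 := two_mul_finrank_inf_ker_involution U (F.superMap v + LinearMap.mulLeft ℂ w)
    F.parity
    (fun x hx => by
      obtain ⟨h1, h2⟩ := (memU x).mp hx
      refine (memU _).mpr ⟨?_, ?_⟩
      · have e1 := F.superMap_superMap F.P_psi hvo (s := 0) (by rw [F.psi_c, zero_smul]) x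
        have e2 := F.superMap_mul_odd (v := F.psi) hwo x
        rw [h1, map_zero, add_zero] at e1
        rw [h1, mul_zero, add_zero, F.psi_bondDag, zero_mul] at e2
        rw [LinearMap.add_apply, map_add, e1, LinearMap.mulLeft_apply, e2, add_zero]
      · have e1 := F.superMap_superMap F.P_psiDag hvo ht x
        have e2 := F.superMap_mul_odd (v := F.psiDag) hwo x
        rw [h2, map_zero, add_zero] at e1
        rw [h2, mul_zero, add_zero, F.psiDag_of_mem_bonds (F.bondDag_mem b), zero_mul] at e2
        rw [LinearMap.add_apply, map_add, e1, LinearMap.mulLeft_apply, e2, add_zero])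
    (fun x hx => by
      obtain ⟨h1, h2⟩ := (memU x).mp hx
      refine (memU _).mpr ⟨?_, ?_⟩
      · rw [← neg_eq_zero, ← F.parity_superMap F.P_psi, h1, map_zero]
      · rw [← neg_eq_zero, ← F.parity_superMap F.P_psiDag, h2, map_zero])
    (fun x _ => by
      have e1 := F.superMap_mul_odd (v := v) hwo x
      rw [hvw, one_mul] at e1
      have e2 := F.superMap_sq hvo (F.c_sq _) x
      simp only [LinearMap.add_apply, LinearMap.mulLeft_apply, map_add, e2, zero_add]
      rw [← mul_assoc w w, hww, zero_mul, add_zero, add_comm, e1])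
    (fun x _ => F.parity_parity x)
    (fun x _ => by
      simp only [LinearMap.add_apply, LinearMap.mulLeft_apply, map_add, F.parity_superMap hvo,
        F.parity_mul_odd hwo, neg_add])
  have hquad : Subalgebra.toSubmodule F.quad = U ⊓ LinearMap.ker (1 - F.parity) := by
    ext x
    have hpar : x - F.parity x = 0 ↔ F.P * x = x * F.P := by
      rw [sub_eq_zero, parity_apply]
      constructor
      · intro h
        nth_rewrite 1 [h]
        exact F.P_mul_P_mul _
      · intro h
        rw [← h, F.P_mul_P_mul]
    rw [Subalgebra.mem_toSubmodule, F.quad_eq_centralizer, Submodule.mem_inf, memU,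
      LinearMap.mem_ker, LinearMap.sub_apply, Module.End.one_apply, hpar]
    simp only [Subalgebra.mem_centralizer_iff, Set.mem_insert_iff, Set.mem_singleton_iff,
      forall_eq_or_imp, forall_eq]
    constructor
    · rintro ⟨hP, h, h'⟩
      exact ⟨⟨(F.superMap_eq_zero_of_commute hP).mpr h,
        (F.superMap_eq_zero_of_commute hP).mpr h'⟩, hP⟩
    · rintro ⟨⟨h, h'⟩, hP⟩
      exact ⟨hP, (F.superMap_eq_zero_of_commute hP).mp h, (F.superMap_eq_zero_of_commute hP).mp h'⟩
  have hfin : Module.finrank ℂ F.quad = Module.finrank ℂ (Subalgebra.toSubmodule F.quad) := rfl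
  rw [hfin, hquad, ← finrank_top ℂ A]
  omega

/-! ### Generation by neighbouring bonds -/

lemma commMap_bondDag_mul_bond (k l : Fin n) :
    commMap (F.bondDag k * F.bond k) (F.bond l) = -(overlap k l • F.bond k) := by
  rw [mul_commMap_of_anticomm (s := 0) (t := overlap k l) (by rw [F.bond_bond, zero_smul])
    (F.bondDag_bond k l), zero_smul, zero_sub]

lemma commMap_bondDag_mul_bondDag (k l : Fin n) :
    commMap (F.bondDag k * F.bond k) (F.bondDag l) = overlap k l • F.bondDag k := by
  rw [mul_commMap_of_anticomm (s := overlap k l) (t := 0) (F.bond_bondDag k l)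
    (by rw [F.bondDag_bondDag, zero_smul]), zero_smul, sub_zero]

/-- Commutators with the number operators of bonds move a bond fermion along the chain. -/
lemma mul_bond_mem (S : Subalgebra ℂ A) (hS : ∀ k, F.bondDag k * F.bond k ∈ S) (z : A) (j : Fin n)
    (hz : ∀ k, overlap j k = 0 → commMap (F.bondDag k * F.bond k) z = 0)
    (hb : ∀ l, overlap j l ≠ 0 → z * F.bond l ∈ S) (l : Fin n) (hl : l ≠ j) :
    z * F.bond l ∈ S := by
  have key : ∀ d : ℕ, ∀ l : Fin n, (l.val + (d + 1) = j.val ∨ j.val + (d + 1) = l.val) →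
      z * F.bond l ∈ S := by
    intro d
    induction d with
    | zero =>
      intro l hl
      refine hb l ?_
      rw [overlap, if_pos (by omega)]
      exact Complex.I_ne_zero
    | succ d ih =>
      intro l hl
      obtain ⟨l', h1, h2⟩ : ∃ l' : Fin n, (l'.val + (d + 1) = j.val ∨ j.val + (d + 1) = l'.val)
          ∧ overlap l l' = I := by
        rcases hl with hl | hl
        · exact ⟨⟨l.val + 1, by omega⟩, Or.inl (by simp; omega), by simp [overlap]⟩
        · refine ⟨⟨l.val - 1, by omega⟩, Or.inr (by simp; omega), ?_⟩
          rw [overlap, if_pos]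
          simp; omega
      -- `l` is at distance at least two from `j`, so `a†ₗaₗ` commutes with `z` and acts only on the
      -- bond `l'`, one step closer to `j`: the commutator with `a_{l'}` is `-i aₗ`.
      have h3 : overlap j l = 0 := by
        rw [overlap, if_neg]; omega
      have h4 : commMap (F.bondDag l * F.bond l) (z * F.bond l') ∈ S :=
        sub_mem (mul_mem (hS l) (ih l' h1)) (mul_mem (ih l' h1) (hS l))
      rw [commMap_mul, hz l h3, zero_mul, zero_add, commMap_bondDag_mul_bond, h2, mul_neg,
        mul_smul_comm] at h4
      have h5 := S.smul_mem h4 I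
      rwa [smul_neg, smul_smul, Complex.I_mul_I, neg_smul, one_smul, neg_neg] at h5
  rcases lt_or_gt_of_ne (Fin.val_ne_of_ne hl) with h | h
  · exact key (j.val - l.val - 1) l (Or.inl (by omega))
  · exact key (l.val - j.val - 1) l (Or.inr (by omega))

lemma bond_mul_bondDag_self (k) : F.bond k * F.bondDag k = -(F.bondDag k * F.bond k) := by
  have := F.bond_bondDag k k
  rw [overlap, if_neg (by omega), zero_smul] at this
  exact eq_neg_of_add_eq_zero_left this

/-- A subalgebra that contains the number operators and the symmetric hopping terms of
neighbouring bonds contains all hopping terms. -/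
lemma bondDag_mul_bond_mem (S : Subalgebra ℂ A) (hS : ∀ k, F.bondDag k * F.bond k ∈ S)
    (hsymm : ∀ j k : Fin n, j.val + 1 = k.val →
      F.bondDag j * F.bond k + F.bondDag k * F.bond j ∈ S) (j l : Fin n) :
    F.bondDag j * F.bond l ∈ S := by
  by_cases h : l = j
  · rw [h]; exact hS j
  have hsymm' : ∀ j k : Fin n, overlap j k ≠ 0 →
      F.bondDag j * F.bond k + F.bondDag k * F.bond j ∈ S := by
    intro j k hjk
    rw [overlap, ite_ne_right_iff] at hjk
    rcases hjk.1 with h | h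
    · exact hsymm j k h
    · rw [add_comm]; exact hsymm k j h
  refine F.mul_bond_mem S hS (F.bondDag j) j ?_ ?_ l h
  · intro k hk
    rw [commMap_bondDag_mul_bondDag, overlap_comm, hk, zero_smul]
  · intro k hk
    -- The commutator of neighbouring number operators is `i (a†ⱼaₖ - a†ₖaⱼ)`. Half the sum of the
    -- antisymmetric and the symmetric hop is the single hop.
    have h1 : commMap (F.bondDag j * F.bond j) (F.bondDag k * F.bond k) ∈ S :=
      sub_mem (mul_mem (hS j) (hS k)) (mul_mem (hS k) (hS j))
    rw [commMap_mul, commMap_bondDag_mul_bondDag, commMap_bondDag_mul_bond, smul_mul_assoc,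
      mul_neg, mul_smul_comm, ← sub_eq_add_neg, ← smul_sub] at h1
    have h2 := S.smul_mem h1 (overlap j k)⁻¹
    rw [inv_smul_smul₀ hk] at h2
    have h3 := S.smul_mem (add_mem h2 (hsymm' j k hk)) (1 / 2)
    convert h3 using 1
    module

/-- Transport as for the hops, starting from the neighbours of `j`; anticommutation provides the
neighbour on the left, and `aⱼ² = 0` settles the diagonal. -/
lemma bond_mul_bond_mem (S : Subalgebra ℂ A) (hS : ∀ k, F.bondDag k * F.bond k ∈ S)
    (hpair : ∀ j k : Fin n, j.val + 1 = k.val → F.bond j * F.bond k ∈ S) (j l : Fin n) :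
    F.bond j * F.bond l ∈ S := by
  by_cases h : l = j
  · have h1 := F.bond_bond j j
    rw [← two_smul ℂ] at h1
    rw [h, (smul_eq_zero.mp h1).resolve_left two_ne_zero]
    exact zero_mem S
  refine F.mul_bond_mem S hS (F.bond j) j ?_ ?_ l h
  · intro k hk
    rw [commMap_bondDag_mul_bond, overlap_comm, hk, zero_smul, neg_zero]
  · intro k hk
    rw [overlap, ite_ne_right_iff] at hk
    rcases hk.1 with h | h
    · exact hpair j k h
    · rw [eq_neg_of_add_eq_zero_left (F.bond_bond j k)]
      exact neg_mem (hpair k j h)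

lemma quad_le (S : Subalgebra ℂ A) (hS : ∀ k, F.bondDag k * F.bond k ∈ S)
    (hsymm : ∀ j k : Fin n, j.val + 1 = k.val →
      F.bondDag j * F.bond k + F.bondDag k * F.bond j ∈ S)
    (hpair : ∀ j k : Fin n, j.val + 1 = k.val → F.bond j * F.bond k ∈ S)
    (hpairDag : ∀ j k : Fin n, j.val + 1 = k.val → F.bondDag j * F.bondDag k ∈ S) :
    F.quad ≤ S := by
  refine Algebra.adjoin_le ?_
  have h := F.bondDag_mul_bond_mem S hS hsymm
  rintro _ ⟨_, ⟨j, rfl⟩ | ⟨j, rfl⟩, _, ⟨k, rfl⟩ | ⟨k, rfl⟩, rfl⟩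
  · exact F.bond_mul_bond_mem S hS hpair j k
  · have h1 : F.bond j * F.bondDag k = overlap j k • 1 - F.bondDag k * F.bond j :=
      eq_sub_of_add_eq (F.bond_bondDag j k)
    rw [h1]
    exact sub_mem (S.smul_mem (one_mem S) _) (h k j)
  · exact h j k
  · exact F.swap.bond_mul_bond_mem S
      (fun k => by rw [swap_bond, swap_bondDag, bond_mul_bondDag_self]; exact neg_mem (hS k))
      hpairDag j k

/-! ### The charge -/

/-- The number operator. -/
def number : A := ∑ j, F.cd j * F.c j

/-- The elements of charge `m`. -/
def charge (m : ℤ) : Submodule ℂ A := (commMap F.number).eigenspace (m : ℂ)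

lemma mem_charge {m : ℤ} {x : A} : x ∈ F.charge m ↔ commMap F.number x = (m : ℂ) • x :=
  Module.End.mem_eigenspace_iff

lemma commMap_sum {ι : Type*} (s : Finset ι) (x : ι → A) (y : A) :
    commMap (∑ i ∈ s, x i) y = ∑ i ∈ s, commMap (x i) y := by
  simp only [commMap_apply, Finset.sum_mul, Finset.mul_sum, Finset.sum_sub_distrib]

lemma c_mem_charge (k) : F.c k ∈ F.charge (-1) := by
  rw [mem_charge, number, commMap_sum]
  have : ∀ j, commMap (F.cd j * F.c j) (F.c k) = -((if k = j then (1 : ℂ) else 0) • F.c j) :=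
    fun j => by
      rw [mul_commMap_of_anticomm (s := 0) (by rw [F.c_c, zero_smul])
        ((add_comm _ _).trans (F.c_cd k j)), zero_smul, zero_sub]
  simp [this]

lemma cd_mem_charge (k) : F.cd k ∈ F.charge 1 := by
  rw [mem_charge, number, commMap_sum]
  have : ∀ j, commMap (F.cd j * F.c j) (F.cd k) = (if j = k then (1 : ℂ) else 0) • F.cd j :=
    fun j => by
      rw [mul_commMap_of_anticomm (t := 0) (F.c_cd j k) (by rw [F.cd_cd, zero_smul]), zero_smul,
        sub_zero]
  simp [this]

lemma bond_mem_charge (k) : F.bond k ∈ F.charge (-1) :=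
  add_mem (F.c_mem_charge _) (Submodule.smul_mem _ _ (F.c_mem_charge _))

lemma bondDag_mem_charge (k) : F.bondDag k ∈ F.charge 1 :=
  add_mem (F.cd_mem_charge _) (Submodule.smul_mem _ _ (F.cd_mem_charge _))

lemma mul_mem_charge {l m : ℤ} {x y : A} (hx : x ∈ F.charge l) (hy : y ∈ F.charge m) :
    x * y ∈ F.charge (l + m) := by
  rw [mem_charge] at *
  rw [commMap_mul, hx, hy, smul_mul_assoc, mul_smul_comm, ← add_smul]
  push_cast
  rfl

lemma one_mem_charge : (1 : A) ∈ F.charge 0 := by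
  rw [mem_charge]; simp

/-- Distinct charges are distinct eigenvalues, so a charge-graded spanning family determines the
charge-zero part. Both parity of neutral elements and generation by hops are read off from such a
family. -/
lemma mem_of_mem_iSup_charge (G : ℤ → Submodule ℂ A) (hG : ∀ m, G m ≤ F.charge m) {x : A}
    (hx : x ∈ ⨆ m, G m) (h0 : x ∈ F.charge 0) : x ∈ G 0 :=
  mem_of_mem_iSup_of_mem_eigenspace (commMap F.number) (fun m : ℤ => (m : ℂ)) Int.cast_injective G
    hG hx h0

/-- Elements of charge zero are even. -/
lemma even_of_mem_charge_zero {x : A} (hx : x ∈ F.charge 0) : F.P * x = x * F.P := by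
  -- Elements of charge `m` with parity `(-1)^m`. Since every fermion is odd and of charge `±1`,
  -- these spaces together span the whole algebra.
  let G : ℤ → Submodule ℂ A := fun m => F.charge m ⊓
    LinearMap.ker (LinearMap.mulLeft ℂ F.P - ((-1 : ℂ) ^ m) • LinearMap.mulRight ℂ F.P)
  have memG : ∀ m x, x ∈ G m ↔ x ∈ F.charge m ∧ F.P * x = (-1 : ℂ) ^ m • (x * F.P) := by
    intro m x
    simp [G, sub_eq_zero]
  have hodd : ∀ g ε, F.P * g = -(g * F.P) → g ∈ F.charge ε → (-1 : ℂ) ^ ε = -1 →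
      ∀ m, ∀ t ∈ G m, g * t ∈ G (ε + m) := by
    intro g ε hg hgε hε m t ht
    rw [memG] at ht ⊢
    refine ⟨F.mul_mem_charge hgε ht.1, ?_⟩
    rw [← mul_assoc, hg, neg_mul, mul_assoc, ht.2, zpow_add₀ (by norm_num), hε, mul_smul_comm,
      neg_one_mul, neg_smul, mul_assoc]
  have htop : (⊤ : Submodule ℂ A) ≤ ⨆ m, G m := by
    rw [← Algebra.top_toSubmodule, ← F.adjoin_eq_top]
    refine adjoin_le_of_mul_mem _ _ (Submodule.mem_iSup_of_mem 0 ?_) ?_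
    · rw [memG]; exact ⟨F.one_mem_charge, by simp⟩
    · intro g hg
      suffices h : (⨆ m, G m) ≤ (⨆ m, G m).comap (LinearMap.mulLeft ℂ g) from fun t ht => h ht
      refine iSup_le fun m t ht => ?_
      rcases hg with ⟨j, rfl⟩ | ⟨j, rfl⟩
      · exact Submodule.mem_iSup_of_mem _
          (hodd _ _ (F.P_c j) (F.c_mem_charge j) (by norm_num) m t ht)
      · exact Submodule.mem_iSup_of_mem _
          (hodd _ _ (F.P_cd j) (F.cd_mem_charge j) (by norm_num) m t ht)
  have h0 := F.mem_of_mem_iSup_charge G (fun m => inf_le_left) (htop trivial) hx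
  simpa using ((memG 0 x).mp h0).2

/-! ### The commutant of `gl(1|1)` -/

/-- The algebra generated by the hopping terms of the bond fermions. -/
def hopAlg : Subalgebra ℂ A := Algebra.adjoin ℂ {x | ∃ j k, x = F.bondDag j * F.bond k}

lemma hop_mem (j k) : F.bondDag j * F.bond k ∈ F.hopAlg := Algebra.subset_adjoin ⟨j, k, rfl⟩

lemma hopAlg_le_quad : F.hopAlg ≤ F.quad := by
  refine Algebra.adjoin_le ?_
  rintro _ ⟨j, k, rfl⟩
  exact F.mul_mem_quad (F.bondDag_mem j) (F.bond_mem k)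

lemma mem_charge_of_mem_hopAlg {x : A} (hx : x ∈ F.hopAlg) : x ∈ F.charge 0 := by
  refine adjoin_le_of_mul_mem _ (F.charge 0) F.one_mem_charge ?_ hx
  rintro _ ⟨j, k, rfl⟩ t ht
  simpa using F.mul_mem_charge (F.mul_mem_charge (F.bondDag_mem_charge j) (F.bond_mem_charge k)) ht

/-- Moving `u` past a hop costs a commutator, which stays in `X` by hypothesis. It is applied to the
span of the `a†ₖ` and the span of the `aₖ`, so that all hops can be collected on the left. -/
lemma mul_hopAlg_le (X : Submodule ℂ A)
    (hX : ∀ j k, ∀ u ∈ X, commMap (F.bondDag j * F.bond k) u ∈ X) :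
    X * Subalgebra.toSubmodule F.hopAlg ≤ Subalgebra.toSubmodule F.hopAlg * X := by
  have key : ∀ b ∈ F.hopAlg, ∀ u ∈ X, u * b ∈ Subalgebra.toSubmodule F.hopAlg * X := by
    intro b hb
    induction hb using Algebra.adjoin_induction with
    | mem x hx =>
      obtain ⟨j, k, rfl⟩ := hx
      intro u hu
      have : u * (F.bondDag j * F.bond k) = (F.bondDag j * F.bond k) * u
          - 1 * commMap (F.bondDag j * F.bond k) u := by
        rw [one_mul, commMap_apply]; abel
      rw [this]
      exact sub_mem (Submodule.mul_mem_mul (F.hop_mem j k) hu)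
        (Submodule.mul_mem_mul (one_mem F.hopAlg) (hX j k u hu))
    | algebraMap r =>
      intro u hu
      rw [← Algebra.commutes]
      exact Submodule.mul_mem_mul (F.hopAlg.algebraMap_mem r) hu
    | add x y _ _ hx hy =>
      intro u hu
      rw [mul_add]
      exact add_mem (hx u hu) (hy u hu)
    | mul x y _ _ hx hy =>
      intro u hu
      rw [← mul_assoc]
      have hle : Subalgebra.toSubmodule F.hopAlg * X ≤
          (Subalgebra.toSubmodule F.hopAlg * X).comap (LinearMap.mulRight ℂ y) := by
        rw [Submodule.mul_le]
        intro a ha v hv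
        rw [Submodule.mem_comap, LinearMap.mulRight_apply, mul_assoc]
        have : Subalgebra.toSubmodule F.hopAlg * X ≤
            (Subalgebra.toSubmodule F.hopAlg * X).comap (LinearMap.mulLeft ℂ a) := by
          rw [Submodule.mul_le]
          intro a' ha' v' hv'
          rw [Submodule.mem_comap, LinearMap.mulLeft_apply, ← mul_assoc]
          exact Submodule.mul_mem_mul (F.hopAlg.mul_mem ha ha') hv'
        exact this (hy v hv)
      exact hle (hx u hu)
  exact Submodule.mul_le.mpr fun g hg b hb => key b hb g hg

end FermionSystem

namespace Sl2Weights

variable {M : Type*} [AddCommGroup M] [Module ℂ M] {E F : Module.End ℂ M} {W : ℤ → Submodule ℂ M}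

/-- The Weyl reflection of a family of weight spaces. -/
lemma symm (h : Sl2Weights E F W) (hn : ∀ m, ∀ v ∈ W m, ∃ k : ℕ, (F ^ k) v = 0) :
    Sl2Weights F E (fun m => W (-m)) where
  raise m v hv := by
    have := h.lower _ v hv
    rwa [neg_add']
  lower m v hv := by
    have := h.raise _ v hv
    rwa [neg_sub, sub_eq_neg_add]
  comm m v hv := by
    have := h.comm _ v hv
    rw [← neg_sub, this, Int.cast_neg, neg_smul, neg_neg]
  nilp m v hv := hn _ v hv

end Sl2Weights

/-! ### The charge-zero part of the bond algebra -/

namespace FermionSystem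

variable {n : ℕ} {A : Type*} [Ring A] [Algebra ℂ A] (F : FermionSystem n A)

lemma charge_mul_charge_le (l m : ℤ) : F.charge l * F.charge m ≤ F.charge (l + m) :=
  Submodule.mul_le.mpr fun _ hx _ hy => F.mul_mem_charge hx hy

lemma pow_le_charge {X : Submodule ℂ A} {l : ℤ} (hX : X ≤ F.charge l) (k : ℕ) :
    X ^ k ≤ F.charge (k * l) := by
  induction k with
  | zero =>
    rw [pow_zero, Submodule.one_le]
    simpa using F.one_mem_charge
  | succ k ih =>
    rw [pow_succ]
    refine (mul_le_mul' ih hX).trans ((F.charge_mul_charge_le _ _).trans (le_of_eq ?_))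
    congr 1
    push_cast; ring

/-- The elements of charge zero in the algebra generated by the bond fermions are generated by the
hopping terms. -/
lemma mem_hopAlg_of_mem_charge_zero {x : A} (hx : x ∈ F.bondAlg) (h0 : x ∈ F.charge 0) :
    x ∈ F.hopAlg := by
  set B := Subalgebra.toSubmodule F.hopAlg with hB
  set X := Submodule.span ℂ (Set.range F.bondDag) with hX
  set Y := Submodule.span ℂ (Set.range F.bond) with hY
  have hXB : X * B ≤ B * X := by
    refine F.mul_hopAlg_le X fun j k u hu => ?_
    have : X ≤ X.comap (commMap (F.bondDag j * F.bond k)) := by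
      rw [hX, Submodule.span_le]
      rintro _ ⟨l, rfl⟩
      rw [SetLike.mem_coe, Submodule.mem_comap,
        mul_commMap_of_anticomm (F.bond_bondDag k l) (t := 0) (by rw [F.bondDag_bondDag, zero_smul]),
        zero_smul, sub_zero]
      exact Submodule.smul_mem _ _ (Submodule.subset_span ⟨j, rfl⟩)
    exact this hu
  have hYB : Y * B ≤ B * Y := by
    refine F.mul_hopAlg_le Y fun j k u hu => ?_
    have : Y ≤ Y.comap (commMap (F.bondDag j * F.bond k)) := by
      rw [hY, Submodule.span_le]
      rintro _ ⟨l, rfl⟩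
      rw [SetLike.mem_coe, Submodule.mem_comap,
        mul_commMap_of_anticomm (s := 0) (by rw [F.bond_bond, zero_smul]) (F.bondDag_bond j l),
        zero_smul, zero_sub]
      exact neg_mem (Submodule.smul_mem _ _ (Submodule.subset_span ⟨k, rfl⟩))
    exact this hu
  have hXY : X * Y ≤ B := by
    rw [hX, hY, Submodule.span_mul_span, Submodule.span_le]
    rintro _ ⟨_, ⟨j, rfl⟩, _, ⟨k, rfl⟩, rfl⟩
    exact F.hop_mem j k
  have hYX : Y * X ≤ B := by
    rw [hX, hY, Submodule.span_mul_span, Submodule.span_le]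
    rintro _ ⟨_, ⟨j, rfl⟩, _, ⟨k, rfl⟩, rfl⟩
    have h1 : F.bond j * F.bondDag k = overlap j k • 1 - F.bondDag k * F.bond j :=
      eq_sub_of_add_eq (F.bond_bondDag j k)
    simp only [SetLike.mem_coe, h1]
    exact sub_mem (B.smul_mem _ (one_mem F.hopAlg)) (F.hop_mem k j)
  have hBB : B * B ≤ B := Submodule.mul_le.mpr fun _ ha _ hb => F.hopAlg.mul_mem ha hb
  -- A further factor from the left passes through `B`; it then either lengthens a string of its own
  -- kind or is absorbed with one opposite factor into a hop.
  have hstep : ∀ (X Y : Submodule ℂ A), X * B ≤ B * X → X * Y ≤ B → ∀ k,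
      X * (B * X ^ k) ≤ B * X ^ (k + 1) ∧ X * (B * Y ^ (k + 1)) ≤ B * Y ^ k := by
    intro X Y hXB hXY k
    constructor
    · calc X * (B * X ^ k) = X * B * X ^ k := (mul_assoc _ _ _).symm
        _ ≤ B * X * X ^ k := mul_le_mul' hXB le_rfl
        _ = B * X ^ (k + 1) := by rw [mul_assoc, pow_succ']
    · calc X * (B * Y ^ (k + 1)) = X * B * Y ^ (k + 1) := (mul_assoc _ _ _).symm
        _ ≤ B * X * Y ^ (k + 1) := mul_le_mul' hXB le_rfl
        _ = B * (X * Y) * Y ^ k := by rw [pow_succ']; simp only [mul_assoc]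
        _ ≤ B * B * Y ^ k := mul_le_mul' (mul_le_mul' le_rfl hXY) le_rfl
        _ ≤ B * Y ^ k := mul_le_mul' hBB le_rfl
  -- At most one of the two truncated exponents is positive: `G m` is `B Xᵐ` for `m ≥ 0` and `B Y⁻ᵐ`
  -- for `m ≤ 0`. It has charge `m`, and `G 0 = B`.
  let G : ℤ → Submodule ℂ A := fun m => B * X ^ m.toNat * Y ^ (-m).toNat
  have Gpos : ∀ k : ℕ, G k = B * X ^ k := fun k => by simp [G]
  have Gneg : ∀ k : ℕ, G (-k) = B * Y ^ k := fun k => by simp [G]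
  have hBc : B ≤ F.charge 0 := fun x hx => F.mem_charge_of_mem_hopAlg hx
  have hXc : X ≤ F.charge 1 := Submodule.span_le.mpr <| by
    rintro _ ⟨j, rfl⟩; exact F.bondDag_mem_charge j
  have hYc : Y ≤ F.charge (-1) := Submodule.span_le.mpr <| by
    rintro _ ⟨j, rfl⟩; exact F.bond_mem_charge j
  have hG : ∀ m, G m ≤ F.charge m := by
    intro m
    obtain ⟨k, rfl | rfl⟩ := m.eq_nat_or_neg
    · rw [Gpos]
      refine (mul_le_mul' hBc (F.pow_le_charge hXc k)).trans
        ((F.charge_mul_charge_le _ _).trans (le_of_eq ?_))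
      simp
    · rw [Gneg]
      refine (mul_le_mul' hBc (F.pow_le_charge hYc k)).trans
        ((F.charge_mul_charge_le _ _).trans (le_of_eq ?_))
      simp
  have hle : Subalgebra.toSubmodule F.bondAlg ≤ ⨆ m, G m := by
    refine adjoin_le_of_mul_mem _ _ (Submodule.mem_iSup_of_mem 0 ?_) ?_
    · have : G 0 = B := by simp [G]
      rw [this]; exact one_mem F.hopAlg
    · intro g hg
      suffices h : (⨆ m, G m) ≤ (⨆ m, G m).comap (LinearMap.mulLeft ℂ g) from fun t ht => h ht
      refine iSup_le fun m t ht => ?_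
      rw [Submodule.mem_comap, LinearMap.mulLeft_apply]
      rcases hg with ⟨j, rfl⟩ | ⟨j, rfl⟩
      · have hgY : F.bond j ∈ Y := Submodule.subset_span ⟨j, rfl⟩
        obtain ⟨k, rfl | rfl⟩ := m.eq_nat_or_neg
        · cases k with
          | zero =>
            refine Submodule.mem_iSup_of_mem (-((0 + 1 : ℕ) : ℤ)) ?_
            rw [Gneg]
            exact (hstep Y X hYB hYX 0).1 (Submodule.mul_mem_mul hgY (by simpa [G] using ht))
          | succ k =>
            refine Submodule.mem_iSup_of_mem (k : ℤ) ?_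
            rw [Gpos] at ht ⊢
            exact (hstep Y X hYB hYX k).2 (Submodule.mul_mem_mul hgY ht)
        · refine Submodule.mem_iSup_of_mem (-((k + 1 : ℕ) : ℤ)) ?_
          rw [Gneg] at ht ⊢
          exact (hstep Y X hYB hYX k).1 (Submodule.mul_mem_mul hgY ht)
      · have hgX : F.bondDag j ∈ X := Submodule.subset_span ⟨j, rfl⟩
        obtain ⟨k, rfl | rfl⟩ := m.eq_nat_or_neg
        · refine Submodule.mem_iSup_of_mem ((k + 1 : ℕ) : ℤ) ?_
          rw [Gpos] at ht ⊢
          exact (hstep X Y hXB hXY k).1 (Submodule.mul_mem_mul hgX ht)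
        · cases k with
          | zero =>
            refine Submodule.mem_iSup_of_mem ((0 + 1 : ℕ) : ℤ) ?_
            rw [Gpos]
            exact (hstep X Y hXB hXY 0).1 (Submodule.mul_mem_mul hgX (by simpa [G] using ht))
          | succ k =>
            refine Submodule.mem_iSup_of_mem (-(k : ℤ)) ?_
            rw [Gneg] at ht ⊢
            exact (hstep X Y hXB hXY k).2 (Submodule.mul_mem_mul hgX ht)
  have hx0 := F.mem_of_mem_iSup_charge G hG (hle hx) h0
  have hG0 : G 0 = B := by simp [G]
  rwa [hG0] at hx0

/-- Neutral elements are even, so commuting with the number operator already includes commuting with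
the parity, and the result for `quad` applies. -/
theorem hopAlg_eq_centralizer :
    F.hopAlg = Subalgebra.centralizer ℂ {F.psiDag, F.psi, F.number} := by
  ext x
  have hcharge : x ∈ F.charge 0 ↔ F.number * x = x * F.number := by
    rw [mem_charge, Int.cast_zero, zero_smul, commMap_apply, sub_eq_zero]
  have hquad : x ∈ F.quad ↔ F.P * x = x * F.P ∧ F.psi * x = x * F.psi ∧
      F.psiDag * x = x * F.psiDag := by
    simp [quad_eq_centralizer, Subalgebra.mem_centralizer_iff]
  simp only [Subalgebra.mem_centralizer_iff, Set.mem_insert_iff, Set.mem_singleton_iff,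
    forall_eq_or_imp, forall_eq, ← hcharge]
  constructor
  · intro hx
    have h := hquad.mp (F.hopAlg_le_quad hx)
    exact ⟨h.2.2, h.2.1, F.mem_charge_of_mem_hopAlg hx⟩
  · rintro ⟨h', h, h0⟩
    exact F.mem_hopAlg_of_mem_charge_zero
      (F.quad_le_bondAlg (hquad.mpr ⟨F.even_of_mem_charge_zero h0, h, h'⟩)) h0

/-! ### The divided powers -/

/-- The pairing operator `∑_{j<k} i^{j+k} c†ⱼ c†ₖ`. -/
def pairing : A := ∑ j : Fin (n + 1), ∑ k : Fin (n + 1) with j < k,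
  I ^ (pos j + pos k) • (F.cd j * F.cd k)

lemma commMap_smul (r : ℂ) (x y : A) : commMap (r • x) y = r • commMap x y := by
  simp only [commMap_apply, smul_mul_assoc, mul_smul_comm, smul_sub]

lemma commMap_pairing_cd (l) : commMap F.pairing (F.cd l) = 0 := by
  rw [pairing, commMap_sum]
  refine Finset.sum_eq_zero fun j _ => ?_
  rw [commMap_sum]
  refine Finset.sum_eq_zero fun k _ => ?_
  rw [commMap_smul, mul_commMap_of_anticomm (s := 0) (t := 0) (by rw [F.cd_cd, zero_smul])
    (by rw [F.cd_cd, zero_smul]), zero_smul, zero_smul, sub_zero, smul_zero]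

/-- On a single site the pairing acts nonlocally: the ordering `j < k` leaves all other sites, with
opposite signs on the two sides of `l`. -/
lemma commMap_pairing_c (l) : commMap F.pairing (F.c l) =
    I ^ pos l • ∑ j, (((if j < l then 1 else 0) - (if l < j then 1 else 0) : ℂ) * I ^ pos j)
      • F.cd j := by
  have h1 : ∀ j k, commMap (F.cd j * F.cd k) (F.c l)
      = (if l = k then (1 : ℂ) else 0) • F.cd j - (if l = j then (1 : ℂ) else 0) • F.cd k :=
    fun j k => mul_commMap_of_anticomm ((add_comm _ _).trans (F.c_cd l k))
      ((add_comm _ _).trans (F.c_cd l j))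
  simp only [pairing, commMap_sum, commMap_smul, h1]
  simp only [Finset.sum_filter]
  have h2 : ∀ j k : Fin (n + 1), (if j < k then I ^ (pos j + pos k) •
      ((if l = k then (1 : ℂ) else 0) • F.cd j - (if l = j then (1 : ℂ) else 0) • F.cd k) else 0)
      = (if l = k then (if j < l then (I ^ pos l * I ^ pos j) • F.cd j else 0) else 0)
        - (if l = j then (if l < k then (I ^ pos l * I ^ pos k) • F.cd k else 0) else 0) := by
    intro j k
    rw [zpow_add₀ Complex.I_ne_zero]
    by_cases h : j < k
    · by_cases hk : l = k
      · subst hk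
        simp [h, h.ne', mul_comm]
      · by_cases hj : l = j
        · subst hj
          simp [h, hk]
        · simp [hk, hj]
    · by_cases hk : l = k
      · subst hk
        by_cases hj : l = j
        · subst hj; simp
        · simp [h, hj]
      · by_cases hj : l = j
        · subst hj; simp [h, hk]
        · simp [hk, hj]
  simp only [h2, Finset.sum_sub_distrib, Finset.sum_ite_eq, Finset.mem_univ, if_true]
  rw [Finset.sum_comm (f := fun j k => if l = j then
    (if l < k then (I ^ pos l * I ^ pos k) • F.cd k else 0) else 0)]
  simp only [Finset.sum_ite_eq, Finset.mem_univ, if_true]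
  rw [← Finset.sum_sub_distrib, Finset.smul_sum]
  refine Finset.sum_congr rfl fun j _ => ?_
  split_ifs <;> module

/-- The sign `(-1)^k`. -/
def bondSign (k : Fin n) : ℂ := I ^ pos k.castSucc * I ^ pos k.castSucc

lemma bondSign_mul_self (k : Fin n) : bondSign k * bondSign k = 1 := by
  rw [bondSign, ← mul_zpow, Complex.I_mul_I, ← mul_zpow]
  norm_num

lemma commMap_pairing_bondDag (k) : commMap F.pairing (F.bondDag k) = 0 := by
  rw [bondDag, map_add, map_smul, commMap_pairing_cd, commMap_pairing_cd, smul_zero, add_zero]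

/-- The nonlocal tails of the two sites of a bond carry opposite coefficients, `iᵏ` and `i · iᵏ⁺¹`,
and cancel away from the bond. What survives on its two sites is again a bond fermion. -/
lemma commMap_pairing_bond (k) : commMap F.pairing (F.bond k) = -(bondSign k • F.bondDag k) := by
  rw [bond, map_add, map_smul, commMap_pairing_c, commMap_pairing_c, pos_succ, I_zpow_succ,
    smul_smul]
  have h1 : I * (I ^ pos k.castSucc * I) = -I ^ pos k.castSucc := by
    rw [mul_comm, mul_assoc, Complex.I_mul_I, mul_neg_one]
  rw [h1, neg_smul, ← sub_eq_add_neg, ← smul_sub, ← Finset.sum_sub_distrib]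
  have h2 : ∀ j : Fin (n + 1),
      (((if j < k.castSucc then 1 else 0) - (if k.castSucc < j then 1 else 0) : ℂ) * I ^ pos j)
        • F.cd j
      - (((if j < k.succ then 1 else 0) - (if k.succ < j then 1 else 0) : ℂ) * I ^ pos j)
        • F.cd j
      = -((if k.castSucc = j then I ^ pos j • F.cd j else 0)
        + (if k.succ = j then I ^ pos j • F.cd j else 0)) := by
    intro j
    simp only [Fin.lt_def, Fin.ext_iff, Fin.val_castSucc, Fin.val_succ]
    rcases lt_trichotomy j.val k.val with h | h | h
    · rw [if_pos h, if_neg (by omega), if_pos (by omega), if_neg (by omega), if_neg (by omega),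
        if_neg (by omega)]
      module
    · rw [if_neg (by omega), if_neg (by omega), if_pos (by omega), if_neg (by omega),
        if_pos (by omega), if_neg (by omega)]
      module
    · by_cases h' : k.val + 1 = j.val
      · rw [if_neg (by omega), if_pos (by omega), if_neg (by omega), if_neg (by omega),
          if_neg (by omega), if_pos (by omega)]
        module
      · rw [if_neg (by omega), if_pos (by omega), if_neg (by omega), if_pos (by omega),
          if_neg (by omega), if_neg (by omega)]
        module
  simp only [h2, Finset.sum_neg_distrib, Finset.sum_add_distrib, Finset.sum_ite_eq,
    Finset.mem_univ, if_true]
  rw [pos_succ, I_zpow_succ, bondDag, bondSign]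
  module

/-- The divided power `e`. -/
def raising : A := I • F.pairing

/-- The divided power `f`. -/
def lowering : A := (-I) • F.swap.pairing

lemma raising_bond (k) : commMap F.raising (F.bond k) = (-(I * bondSign k)) • F.bondDag k := by
  rw [raising, commMap_smul, commMap_pairing_bond]; module

lemma raising_bondDag (k) : commMap F.raising (F.bondDag k) = 0 := by
  rw [raising, commMap_smul, commMap_pairing_bondDag, smul_zero]

lemma lowering_bond (k) : commMap F.lowering (F.bond k) = 0 := by
  rw [lowering, commMap_smul, ← swap_bondDag, commMap_pairing_bondDag, smul_zero]

lemma lowering_bondDag (k) : commMap F.lowering (F.bondDag k) = (I * bondSign k) • F.bond k := by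
  rw [lowering, commMap_smul, ← swap_bond, commMap_pairing_bond, swap_bondDag]; module

lemma commMap_mem_quad (d : A)
    (h : ∀ u ∈ F.bonds, commMap d u ∈ Submodule.span ℂ F.bonds) {x : A} (hx : x ∈ F.quad) :
    commMap d x ∈ F.quad := by
  refine commMap_mem_adjoin _ d ?_ hx
  rintro _ ⟨u, hu, v, hv, rfl⟩
  have hl : ∀ v ∈ F.bonds, Submodule.span ℂ F.bonds
      ≤ (Subalgebra.toSubmodule F.quad).comap (LinearMap.mulRight ℂ v) := fun v hv =>
    Submodule.span_le.mpr fun u hu => F.mul_mem_quad hu hv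
  have hr : ∀ u ∈ F.bonds, Submodule.span ℂ F.bonds
      ≤ (Subalgebra.toSubmodule F.quad).comap (LinearMap.mulLeft ℂ u) := fun u hu =>
    Submodule.span_le.mpr fun v hv => F.mul_mem_quad hu hv
  rw [commMap_mul]
  exact F.quad.add_mem (hl v hv (h u hu)) (hr u hu (h v hv))

lemma raising_mem_quad {x : A} (hx : x ∈ F.quad) : commMap F.raising x ∈ F.quad := by
  refine F.commMap_mem_quad _ ?_ hx
  rintro _ (⟨k, rfl⟩ | ⟨k, rfl⟩)
  · rw [raising_bond]
    exact Submodule.smul_mem _ _ (Submodule.subset_span (F.bondDag_mem k))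
  · rw [raising_bondDag]; exact zero_mem _

lemma lowering_mem_quad {x : A} (hx : x ∈ F.quad) : commMap F.lowering x ∈ F.quad := by
  refine F.commMap_mem_quad _ ?_ hx
  rintro _ (⟨k, rfl⟩ | ⟨k, rfl⟩)
  · rw [lowering_bond]; exact zero_mem _
  · rw [lowering_bondDag]
    exact Submodule.smul_mem _ _ (Submodule.subset_span (F.bond_mem k))

lemma commMap_mem_charge {l m : ℤ} {x y : A} (hx : x ∈ F.charge l) (hy : y ∈ F.charge m) :
    commMap x y ∈ F.charge (m + l) :=
  sub_mem (add_comm l m ▸ F.mul_mem_charge hx hy) (F.mul_mem_charge hy hx)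

lemma raising_mem_charge : F.raising ∈ F.charge 2 := by
  have h : ∀ j k, F.cd j * F.cd k ∈ F.charge 2 := fun j k => by
    have := F.mul_mem_charge (F.cd_mem_charge j) (F.cd_mem_charge k)
    norm_num at this
    exact this
  rw [raising, pairing]
  exact (F.charge 2).smul_mem _
    (sum_mem fun j _ => sum_mem fun k _ => (F.charge 2).smul_mem _ (h j k))

lemma lowering_mem_charge : F.lowering ∈ F.charge (-2) := by
  have h : ∀ j k, F.c j * F.c k ∈ F.charge (-2) := fun j k => by
    have := F.mul_mem_charge (F.c_mem_charge j) (F.c_mem_charge k)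
    norm_num at this
    exact this
  rw [lowering, pairing]
  exact (F.charge (-2)).smul_mem _
    (sum_mem fun j _ => sum_mem fun k _ => (F.charge (-2)).smul_mem _ (h j k))

/-- If no power killed `v`, the vectors `Tᵏ v` would be eigenvectors of the charge with infinitely
many distinct eigenvalues. -/
lemma exists_pow_eq_zero [FiniteDimensional ℂ A] (T : Module.End ℂ A) (r : ℤ) (hr : r ≠ 0)
    (hT : ∀ m, ∀ v ∈ F.charge m, T v ∈ F.charge (m + r)) {m : ℤ} {v : A} (hv : v ∈ F.charge m) :
    ∃ k : ℕ, (T ^ k) v = 0 := by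
  by_contra! hne
  have hmem : ∀ k : ℕ, (T ^ k) v ∈ F.charge (m + r * k) := by
    intro k
    induction k with
    | zero => simpa using hv
    | succ k ih =>
      rw [pow_succ', Module.End.mul_apply]
      convert hT _ _ ih using 2
      push_cast; ring
  have hinj : Function.Injective fun k : ℕ => ((m + r * k : ℤ) : ℂ) := by
    intro a b hab
    have : m + r * a = m + r * b := Int.cast_injective hab
    have := mul_left_cancel₀ hr (add_left_cancel this)
    exact_mod_cast this
  refine Set.infinite_range_of_injective hinj
    ((Module.End.finite_hasEigenvalue (commMap F.number)).subset ?_)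
  rintro _ ⟨k, rfl⟩
  exact Module.End.hasEigenvalue_of_hasEigenvector ⟨hmem k, hne k⟩

/-- The elements of charge `m` of the algebra `quad`. -/
def weight (m : ℤ) : Submodule ℂ A := Subalgebra.toSubmodule F.quad ⊓ F.charge m

/-- Both sides are derivations of the bond algebra, so they need only be compared on the doublets
`(aₖ, a†ₖ)`, where the square of the sign is `1` and the weights are `∓1`. -/
lemma commMap_comm_apply {x : A} (hx : x ∈ F.bondAlg) :
    commMap F.raising (commMap F.lowering x) - commMap F.lowering (commMap F.raising x)
      = commMap F.number x := by
  have h1 : ∀ y, commMap F.raising (commMap F.lowering y)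
      - commMap F.lowering (commMap F.raising y)
      = commMap (F.raising * F.lowering - F.lowering * F.raising) y := by
    intro y
    simp only [commMap_apply]
    noncomm_ring
  rw [h1]
  refine commMap_eq_of_adjoin _ _ _ ?_ hx
  rintro _ (⟨k, rfl⟩ | ⟨k, rfl⟩)
  · rw [← h1, lowering_bond, map_zero, raising_bond, map_smul, lowering_bondDag, smul_smul,
      F.mem_charge.mp (F.bond_mem_charge k)]
    have : -(I * bondSign k) * (I * bondSign k) = 1 := by
      linear_combination (-(bondSign k * bondSign k)) * Complex.I_mul_I + bondSign_mul_self k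
    rw [this]; simp
  · rw [← h1, raising_bondDag, map_zero, lowering_bondDag, map_smul, raising_bond, smul_smul,
      F.mem_charge.mp (F.bondDag_mem_charge k)]
    have : I * bondSign k * -(I * bondSign k) = 1 := by
      linear_combination (-(bondSign k * bondSign k)) * Complex.I_mul_I + bondSign_mul_self k
    rw [this]; simp

lemma sl2Weights [FiniteDimensional ℂ A] :
    Sl2Weights (commMap F.raising) (commMap F.lowering) F.weight where
  raise m v hv := ⟨F.raising_mem_quad hv.1, F.commMap_mem_charge F.raising_mem_charge hv.2⟩
  lower m v hv := ⟨F.lowering_mem_quad hv.1, F.commMap_mem_charge F.lowering_mem_charge hv.2⟩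
  comm m v hv := by
    rw [F.commMap_comm_apply (F.quad_le_bondAlg hv.1)]
    exact F.mem_charge.mp hv.2
  nilp m v hv := F.exists_pow_eq_zero _ 2 two_ne_zero
    (fun _ _ => F.commMap_mem_charge F.raising_mem_charge) hv.2

/-- Bonds have odd charge, so products of two have even charge. This parity is essential: only even
weights can be reached from weight zero. -/
lemma quad_le_iSup_weight : Subalgebra.toSubmodule F.quad ≤ ⨆ m : ℤ, F.weight (2 * m) := by
  refine adjoin_le_of_mul_mem _ _
    (Submodule.mem_iSup_of_mem 0 ⟨one_mem F.quad, by simpa using F.one_mem_charge⟩) ?_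
  rintro _ ⟨u, hu, v, hv, rfl⟩
  suffices h : (⨆ m : ℤ, F.weight (2 * m)) ≤
      (⨆ m : ℤ, F.weight (2 * m)).comap (LinearMap.mulLeft ℂ (u * v)) from fun t ht => h ht
  have hc : ∀ u ∈ F.bonds, ∃ s : ℤ, u ∈ F.charge (2 * s + 1) := by
    rintro _ (⟨k, rfl⟩ | ⟨k, rfl⟩)
    · exact ⟨-1, by norm_num; exact F.bond_mem_charge k⟩
    · exact ⟨0, by norm_num; exact F.bondDag_mem_charge k⟩
  obtain ⟨s, hs⟩ := hc u hu
  obtain ⟨s', hs'⟩ := hc v hv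
  refine iSup_le fun m t ht => Submodule.mem_iSup_of_mem (s + s' + 1 + m)
    ⟨F.quad.mul_mem (F.mul_mem_quad hu hv) ht.1, ?_⟩
  have h := F.mul_mem_charge (F.mul_mem_charge hs hs') ht.2
  have e : 2 * s + 1 + (2 * s' + 1) + 2 * m = 2 * (s + s' + 1 + m) := by ring
  rw [e] at h
  exact h

/-- Positive weights come from weight zero by powers of `e`, negative ones by powers of `f` after a
Weyl reflection; weight zero in `quad` is `hopAlg`. Conversely `quad` is stable under both divided
powers. -/
theorem quad_eq_span [FiniteDimensional ℂ A] :
    Subalgebra.toSubmodule F.quad = Submodule.span ℂ {x | ∃ u ∈ Algebra.adjoin ℂ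
      {commMap F.raising, commMap F.lowering}, ∃ b ∈ Subalgebra.toSubmodule F.hopAlg,
        x = u b} := by
  apply le_antisymm
  · refine F.quad_le_iSup_weight.trans (iSup_le fun m x hx => Submodule.subset_span ?_)
    have hhop : ∀ w ∈ F.weight 0, w ∈ F.hopAlg := fun w hw =>
      F.mem_hopAlg_of_mem_charge_zero (F.quad_le_bondAlg hw.1) hw.2
    obtain ⟨k, rfl | rfl⟩ := m.eq_nat_or_neg
    · obtain ⟨w, hw, rfl⟩ := F.sl2Weights.exists_pow_eq k hx
      exact ⟨_, pow_mem (Algebra.subset_adjoin (by simp)) k, w, hhop w hw, rfl⟩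
    · have h := F.sl2Weights.symm fun m v hv => F.exists_pow_eq_zero _ (-2) (by norm_num)
        (fun _ _ => F.commMap_mem_charge F.lowering_mem_charge) hv.2
      obtain ⟨w, hw, rfl⟩ := h.exists_pow_eq k (v := x) (by simpa using hx)
      exact ⟨_, pow_mem (Algebra.subset_adjoin (by simp)) k, w, hhop w (by simpa using hw), rfl⟩
  · rw [Submodule.span_le]
    rintro _ ⟨u, hu, b, hb, rfl⟩
    have key : ∀ x ∈ F.quad, u x ∈ F.quad := by
      induction hu using Algebra.adjoin_induction with
      | mem u hu =>
        rcases hu with rfl | rfl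
        · exact fun x => F.raising_mem_quad
        · exact fun x => F.lowering_mem_quad
      | algebraMap r => exact fun x hx => F.quad.smul_mem hx r
      | add u v _ _ hu hv => exact fun x hx => add_mem (hu x hx) (hv x hx)
      | mul u v _ _ hu hv => exact fun x hx => hu _ (hv x hx)
    exact key b (F.hopAlg_le_quad hb)

end FermionSystem

/-! ## The fermions of the spin chain -/

section Chain

variable {N : ℕ}

lemma strand_eq_update (A B C : Module.End ℂ Site) (j : Fin N) :
    strand N A B C j = prodOp (Function.update (fun l => if l < j then A else C) j B) := by
  rw [strand]
  congr 1
  funext l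
  by_cases h : l = j
  · subst h; simp
  · simp [h]

lemma strand_add (A B B' C : Module.End ℂ Site) (j : Fin N) :
    strand N A (B + B') C j = strand N A B C j + strand N A B' C j := by
  simp only [strand_eq_update, prodOp_update_add]

lemma strand_smul (A B C : Module.End ℂ Site) (r : ℂ) (j : Fin N) :
    strand N A (r • B) C j = r • strand N A B C j := by
  simp only [strand_eq_update, prodOp_update_smul]

lemma strand_mul_strand (A B C A' B' C' : Module.End ℂ Site) (j : Fin N) :
    strand N A B C j * strand N A' B' C' j = strand N (A * A') (B * B') (C * C') j := by
  simp only [strand, prodOp_mul]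
  congr 1
  funext l
  split_ifs <;> rfl

lemma strand_one (j : Fin N) : strand N 1 1 1 j = 1 := by
  simp only [strand, ite_self, prodOp_one]

/-- The sign arises at the smaller of the two sites, where the string of one operator meets the
local factor of the other; at all other sites the factors commute. -/
lemma strand_anticomm {A B A' B' : Module.End ℂ Site} (hAA : A * A' = A' * A)
    (hBA : B * A' = (-1 : ℂ) • (A' * B)) (hAB : A * B' = (-1 : ℂ) • (B' * A)) {j k : Fin N}
    (hjk : j ≠ k) :
    strand N A B 1 j * strand N A' B' 1 k = (-1 : ℂ) • (strand N A' B' 1 k * strand N A B 1 j) := by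
  simp only [strand, prodOp_mul]
  rcases lt_or_gt_of_ne hjk with h | h
  · refine prodOp_eq_smul j _ (by simpa [h] using hBA) fun l hl => ?_
    rcases lt_or_gt_of_ne hl with h' | h'
    · simp [h', h'.trans h, hAA]
    · simp [h'.not_gt, h'.ne']
  · refine prodOp_eq_smul k _ (by simpa [h] using hAB) fun l hl => ?_
    rcases lt_or_gt_of_ne hl with h' | h'
    · simp [h', h'.trans h, hAA]
    · simp [h'.not_gt, h'.ne']

lemma siteK_eq : siteK = I • sigmaZ := by
  rw [siteK, sigmaZ, ← map_smul]
  congr 1; ext a b; fin_cases a <;> fin_cases b <;> simp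

lemma siteKinv_eq : siteKinv = I⁻¹ • sigmaZ := by
  rw [siteKinv, sigmaZ, ← map_smul]
  congr 1; ext a b; fin_cases a <;> fin_cases b <;> simp

lemma sigmaZ_sq : sigmaZ * sigmaZ = 1 := by
  rw [sigmaZ, toLin_mul, Module.End.one_eq_id, ← Matrix.toLin'_one]
  congr 1; ext a b; fin_cases a <;> fin_cases b <;> simp

lemma sigmaZ_sigmaPlus : sigmaZ * sigmaPlus = (-1 : ℂ) • (sigmaPlus * sigmaZ) := by
  rw [sigmaZ, sigmaPlus, toLin_mul, toLin_mul, ← map_smul]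
  congr 1; ext a b; fin_cases a <;> fin_cases b <;> simp

lemma sigmaZ_sigmaMinus : sigmaZ * sigmaMinus = (-1 : ℂ) • (sigmaMinus * sigmaZ) := by
  rw [sigmaZ, sigmaMinus, toLin_mul, toLin_mul, ← map_smul]
  congr 1; ext a b; fin_cases a <;> fin_cases b <;> simp

lemma sigmaPlus_mul_sigmaMinus_add : sigmaMinus * sigmaPlus + sigmaPlus * sigmaMinus = 1 := by
  rw [sigmaMinus, sigmaPlus, toLin_mul, toLin_mul, ← map_add, Module.End.one_eq_id,
    ← Matrix.toLin'_one]
  congr 1; ext a b; fin_cases a <;> fin_cases b <;> simp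

lemma sigmaZ_eq : sigmaZ = (2 : ℂ) • (sigmaPlus * sigmaMinus) + (-1 : ℂ) • 1 := by
  rw [sigmaMinus, sigmaPlus, sigmaZ, toLin_mul, Module.End.one_eq_id, ← Matrix.toLin'_one,
    ← map_smul, ← map_smul, ← map_add]
  congr 1; ext a b; fin_cases a <;> fin_cases b <;> norm_num

/-- The parity operator `σᶻ ⊗ ⋯ ⊗ σᶻ`. -/
def chainParity (N : ℕ) : Op N := prodOp fun _ => sigmaZ

lemma chainParity_sq : chainParity N * chainParity N = 1 := by
  rw [chainParity, prodOp_mul]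
  simp only [sigmaZ_sq, prodOp_one]

lemma chainParity_mul_strand {A B : Module.End ℂ Site} (hA : sigmaZ * A = A * sigmaZ)
    (hB : sigmaZ * B = (-1 : ℂ) • (B * sigmaZ)) (j : Fin N) :
    chainParity N * strand N A B 1 j = (-1 : ℂ) • (strand N A B 1 j * chainParity N) := by
  simp only [strand, prodOp_mul, chainParity]
  refine prodOp_eq_smul j _ (by simpa using hB) fun l hl => ?_
  rcases lt_or_gt_of_ne hl with h' | h'
  · simp [h', hA]
  · simp [h'.not_gt, h'.ne']

lemma sigmaZ_siteK : sigmaZ * siteK = siteK * sigmaZ := by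
  rw [siteK_eq, mul_smul_comm, smul_mul_assoc]

lemma sigmaZ_siteKinv : sigmaZ * siteKinv = siteKinv * sigmaZ := by
  rw [siteKinv_eq, mul_smul_comm, smul_mul_assoc]

lemma smul_anticomm {x y : Op N} (h : x * y = (-1 : ℂ) • (y * x)) (r s : ℂ) :
    (r • x) * (s • y) + (s • y) * (r • x) = 0 := by
  rw [smul_mul_smul_comm, smul_mul_smul_comm, h]
  module

lemma cann_cann (j k : Fin N) : cann j * cann k + cann k * cann j = 0 :=
  smul_anticomm (strandF_anti j k) _ _

lemma cdag_cdag (j k : Fin N) : cdag j * cdag k + cdag k * cdag j = 0 := by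
  refine smul_anticomm ?_ _ _
  by_cases h : j = k
  · subst h
    have : strand N siteK sigmaPlus 1 j * strand N siteK sigmaPlus 1 j = 0 := by
      simp only [strand, prodOp_mul]
      exact prodOp_eq_zero j (by simp [sigmaPlus_sq])
    rw [this, smul_zero]
  · refine strand_anticomm rfl ?_ siteK_sigmaPlus h
    rw [siteK_sigmaPlus, smul_smul]; norm_num

lemma I_inv_pow_mul_I_pow (m : ℕ) : I⁻¹ ^ m * I ^ m = 1 := by
  rw [← mul_pow, inv_mul_cancel₀ Complex.I_ne_zero, one_pow]

lemma cdag_mul_cann_self (j : Fin N) :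
    cdag j * cann j = strand N 1 (sigmaPlus * sigmaMinus) 1 j := by
  rw [cann, cdag, smul_mul_smul_comm, mul_comm (I ^ _), I_inv_pow_mul_I_pow, one_smul,
    strand_mul_strand, siteK_mul_siteKinv, one_mul]

lemma cann_cdag (j k : Fin N) :
    cann j * cdag k + cdag k * cann j = (if j = k then (1 : ℂ) else 0) • 1 := by
  by_cases h : j = k
  · subst h
    rw [cdag_mul_cann_self, cann, cdag, smul_mul_smul_comm, I_inv_pow_mul_I_pow, one_smul,
      strand_mul_strand, siteKinv_mul_siteK, one_mul, ← strand_add, sigmaPlus_mul_sigmaMinus_add,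
      strand_one, if_pos rfl, one_smul]
  · rw [if_neg h, zero_smul]
    refine smul_anticomm (strand_anticomm ?_ ?_ siteKinv_sigmaPlus h) _ _
    · rw [siteKinv_mul_siteK, siteK_mul_siteKinv]
    · rw [siteK_sigmaMinus, smul_smul]; norm_num

lemma chainParity_cann (j : Fin N) : chainParity N * cann j = -(cann j * chainParity N) := by
  rw [cann, mul_smul_comm, chainParity_mul_strand sigmaZ_siteKinv sigmaZ_sigmaMinus,
    smul_mul_assoc]
  module

lemma chainParity_cdag (j : Fin N) : chainParity N * cdag j = -(cdag j * chainParity N) := by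
  rw [cdag, mul_smul_comm, chainParity_mul_strand sigmaZ_siteK sigmaZ_sigmaPlus, smul_mul_assoc]
  module

/-! ### The fermions generate all operators -/

/-- A product operator belongs to every subalgebra that contains its factors. -/
lemma prodOp_mem (S : Subalgebra ℂ (Op N)) (f : Fin N → Module.End ℂ Site)
    (h : ∀ l, strand N 1 (f l) 1 l ∈ S) : prodOp f ∈ S := by
  classical
  have key : ∀ s : Finset (Fin N), prodOp (fun l => if l ∈ s then f l else 1) ∈ S := by
    intro s
    induction s using Finset.induction_on with
    | empty => simp [prodOp_one]
    | insert a s ha ih =>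
      have : prodOp (fun l => if l ∈ insert a s then f l else 1)
          = strand N 1 (f a) 1 a * prodOp (fun l => if l ∈ s then f l else 1) := by
        rw [strand, prodOp_mul]
        congr 1
        funext l
        by_cases hl : l = a
        · subst hl; simp [ha]
        · simp [hl]
      rw [this]
      exact mul_mem (h a) ih
  simpa using key Finset.univ

lemma site_eq (M : Matrix (Fin 2) (Fin 2) ℂ) : (Matrix.toLin' M : Module.End ℂ Site)
    = (M 0 0 - M 1 1) • (sigmaPlus * sigmaMinus) + M 0 1 • sigmaPlus + M 1 0 • sigmaMinus
      + M 1 1 • 1 := by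
  rw [sigmaMinus, sigmaPlus, toLin_mul, Module.End.one_eq_id, ← Matrix.toLin'_one]
  simp only [← map_smul, ← map_add]
  congr 1; ext a b; fin_cases a <;> fin_cases b <;> simp

/-- Inverse Jordan–Wigner transformation: `c†ⱼcⱼ` has no string and yields `σᶻⱼ`, products of these
undo the strings of `c†ⱼ` and `cⱼ`, and the local matrices follow. -/
lemma strand_one_mem (S : Subalgebra ℂ (Op N)) (hc : ∀ j, cann j ∈ S) (hd : ∀ j, cdag j ∈ S)
    (B : Module.End ℂ Site) (j : Fin N) : strand N 1 B 1 j ∈ S := by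
  have hn : ∀ j, strand N 1 (sigmaPlus * sigmaMinus) 1 j ∈ S := fun j => by
    rw [← cdag_mul_cann_self]; exact mul_mem (hd j) (hc j)
  have hz : ∀ j, strand N 1 sigmaZ 1 j ∈ S := fun j => by
    rw [sigmaZ_eq, strand_add, strand_smul, strand_smul, strand_one]
    exact add_mem (S.smul_mem (hn j) _) (S.smul_mem (one_mem S) _)
  have hstring : ∀ r : ℂ, prodOp (fun l => if l < j then r • sigmaZ else 1) ∈ S := by
    intro r
    refine prodOp_mem S _ fun l => ?_
    split_ifs
    · rw [strand_smul]; exact S.smul_mem (hz l) r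
    · rw [strand_one]; exact one_mem S
  have hp : strand N 1 sigmaPlus 1 j ∈ S := by
    have h1 : strand N siteK sigmaPlus 1 j ∈ S := by
      have := S.smul_mem (hd j) (I ^ j.val)⁻¹
      rwa [cdag, inv_smul_smul₀ (pow_ne_zero _ Complex.I_ne_zero)] at this
    have h2 : strand N 1 sigmaPlus 1 j
        = prodOp (fun l => if l < j then I⁻¹ • sigmaZ else 1) * strand N siteK sigmaPlus 1 j := by
      rw [strand, strand, prodOp_mul, ← siteKinv_eq]
      congr 1
      funext l
      by_cases hl : l < j
      · simp [hl, siteKinv_mul_siteK]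
      · simp [hl]
    rw [h2]
    exact mul_mem (hstring _) h1
  have hm : strand N 1 sigmaMinus 1 j ∈ S := by
    have h1 : strand N siteKinv sigmaMinus 1 j ∈ S := by
      have := S.smul_mem (hc j) (I⁻¹ ^ j.val)⁻¹
      rwa [cann, inv_smul_smul₀ (pow_ne_zero _ (inv_ne_zero Complex.I_ne_zero))] at this
    have h2 : strand N 1 sigmaMinus 1 j
        = prodOp (fun l => if l < j then I • sigmaZ else 1) * strand N siteKinv sigmaMinus 1 j := by
      rw [strand, strand, prodOp_mul, ← siteK_eq]
      congr 1
      funext l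
      by_cases hl : l < j
      · simp [hl, siteK_mul_siteKinv]
      · simp [hl]
    rw [h2]
    exact mul_mem (hstring _) h1
  rw [← Matrix.toLin'_toMatrix' B, site_eq]
  simp only [strand_add, strand_smul, strand_one]
  exact add_mem (add_mem (add_mem (S.smul_mem (hn j) _) (S.smul_mem hp _)) (S.smul_mem hm _))
    (S.smul_mem (one_mem S) _)

/-- The basis of product states. -/
def chainBasis (N : ℕ) : Module.Basis (Fin N → Fin 2) ℂ (SpinChain N) :=
  Basis.piTensorProduct fun _ => Pi.basisFun ℂ (Fin 2)

lemma chainBasis_apply (p : Fin N → Fin 2) :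
    chainBasis N p = (⨂ₜ[ℂ] l, Pi.basisFun ℂ (Fin 2) (p l) : ⨂[ℂ] _ : Fin N, Site) :=
  Basis.piTensorProduct_apply _ p

instance : FiniteDimensional ℂ (SpinChain N) := (chainBasis N).finiteDimensional_of_finite

lemma finrank_op : Module.finrank ℂ (Op N) = 2 ^ (2 * N) := by
  rw [Module.finrank_linearMap, Module.finrank_eq_card_basis (chainBasis N)]
  simp [two_mul, pow_add]

/-- The matrix units of the basis of product states are product operators. -/
lemma toLin_single (p q : Fin N → Fin 2) :
    Matrix.toLin (chainBasis N) (chainBasis N) (Matrix.single p q 1)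
      = prodOp fun l => Matrix.toLin' (Matrix.single (p l) (q l) 1) := by
  refine (chainBasis N).ext fun r => ?_
  have hr : (prodOp fun l => Matrix.toLin' (Matrix.single (p l) (q l) (1 : ℂ))) (chainBasis N r)
      = (⨂ₜ[ℂ] l, Matrix.toLin' (Matrix.single (p l) (q l) (1 : ℂ)) (Pi.basisFun ℂ (Fin 2) (r l)) :
        ⨂[ℂ] _ : Fin N, Site) := by
    rw [chainBasis_apply]
    exact PiTensorProduct.map_tprod _ _
  have hsite : ∀ a b c : Fin 2, Matrix.toLin' (Matrix.single a b (1 : ℂ)) (Pi.basisFun ℂ (Fin 2) c)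
      = if b = c then Pi.basisFun ℂ (Fin 2) a else 0 := by
    intro a b c
    ext d
    fin_cases a <;> fin_cases b <;> fin_cases c <;> fin_cases d <;>
      simp [Matrix.single, Matrix.mulVec, dotProduct]
  rw [Matrix.toLin_self, hr]
  simp only [hsite]
  by_cases h : q = r
  · subst h
    simp only [if_true]
    rw [← chainBasis_apply, Finset.sum_eq_single p]
    · simp [Matrix.single]
    · intro s _ hs
      simp [Matrix.single, hs.symm]
    · simp
  · obtain ⟨l, hl⟩ := Function.ne_iff.mp h
    rw [Finset.sum_eq_zero]
    · exact ((PiTensorProduct.tprod ℂ).map_coord_zero l (by simp [hl])).symm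
    · intro s _
      simp [Matrix.single, h]

/-- Local operators lie in the generated algebra, hence so do product operators, among them all
matrix units of the product basis. -/
lemma adjoin_fermions_eq_top :
    Algebra.adjoin ℂ (Set.range (cann (N := N)) ∪ Set.range (cdag (N := N))) = ⊤ := by
  rw [eq_top_iff]
  intro T _
  set S := Algebra.adjoin ℂ (Set.range (cann (N := N)) ∪ Set.range (cdag (N := N)))
  have hprod : ∀ f, prodOp f ∈ S := fun f => prodOp_mem S f fun l =>
    strand_one_mem S (fun j => Algebra.subset_adjoin (Or.inl ⟨j, rfl⟩))
      (fun j => Algebra.subset_adjoin (Or.inr ⟨j, rfl⟩)) _ _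
  rw [← Matrix.toLin_toMatrix (chainBasis N) (chainBasis N) T,
    Matrix.matrix_eq_sum_single (LinearMap.toMatrix (chainBasis N) (chainBasis N) T), map_sum]
  refine sum_mem fun p _ => ?_
  rw [map_sum]
  refine sum_mem fun q _ => ?_
  have : ∀ r : ℂ, Matrix.single p q r = r • Matrix.single p q 1 := fun r => by simp
  rw [this, map_smul, toLin_single]
  exact S.smul_mem (hprod _) _

end Chain

/-- The fermions of the spin chain with `n + 1` sites. -/
@[simps] def chainFermions (n : ℕ) : FermionSystem n (Op (n + 1)) where
  c := cann
  cd := cdag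
  P := chainParity (n + 1)
  P_mul_P := chainParity_sq
  P_c := chainParity_cann
  P_cd := chainParity_cdag
  c_c := cann_cann
  cd_cd := cdag_cdag
  c_cd := cann_cdag
  adjoin_eq_top := adjoin_fermions_eq_top

/-! ## Translation to the spin chain -/

section Chain

variable {N : ℕ}

lemma prodOp_smul_univ (r : Fin N → ℂ) (f : Fin N → Module.End ℂ Site) :
    prodOp (fun l => r l • f l) = (∏ l, r l) • prodOp f :=
  (PiTensorProduct.mapMultilinear ℂ (fun _ : Fin N => Site) (fun _ => Site)).map_smul_univ r f

lemma chainK_eq : chainK N = I ^ N • chainParity N := by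
  rw [chainK, chainParity, siteK_eq, prodOp_smul_univ]
  simp

lemma chainKinv_eq : chainKinv N = I⁻¹ ^ N • chainParity N := by
  rw [chainKinv, chainParity, siteKinv_eq, prodOp_smul_univ]
  simp

lemma prod_ite_lt (r : ℂ) (j : Fin N) : ∏ l : Fin N, (if l < j then r else 1) = r ^ j.val := by
  rw [Finset.prod_ite, Finset.prod_const, Finset.prod_const_one, mul_one]
  rw [Finset.filter_gt_eq_Iio, Fin.card_Iio]

/-- At each of the `j` sites of the string, `i^{-σᶻ} = -i^{σᶻ}`. -/
lemma strand_siteKinv (B : Module.End ℂ Site) (j : Fin N) :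
    strand N siteKinv B 1 j = (-1 : ℂ) ^ j.val • strand N siteK B 1 j := by
  rw [← prod_ite_lt, strand, strand, ← prodOp_smul_univ]
  congr 1
  funext l
  split_ifs
  · rw [siteK_eq, siteKinv_eq, smul_smul, Complex.inv_I, neg_one_mul]
  · rw [one_smul]
  · rw [one_smul]

lemma sigmaPlus_siteKinv : sigmaPlus * siteKinv = I • sigmaPlus := by
  rw [siteKinv, sigmaPlus, toLin_mul, ← map_smul]
  congr 1; ext a b; fin_cases a <;> fin_cases b <;> simp

/-- Multiplication by `K⁻¹` cancels the string to the right of each `σ⁺` and creates one to the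
left, turning the coproduct of `E` into Jordan–Wigner form. The local factor `σ⁺ i^{-σᶻ} = i σ⁺`
shifts the exponent to the site number counted from one. -/
lemma chainE_mul_chainKinv : chainE N * chainKinv N = glPsiDag N := by
  rw [chainE, glPsiDag, Finset.sum_mul]
  refine Finset.sum_congr rfl fun j _ => ?_
  have h1 : strand N 1 sigmaPlus siteK j * chainKinv N
      = strand N siteKinv (sigmaPlus * siteKinv) 1 j := by
    simp only [strand, chainKinv, prodOp_mul]
    congr 1
    funext l
    split_ifs
    · rw [one_mul]
    · rfl
    · rw [siteK_mul_siteKinv]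
  have h2 : (-1 : ℂ) ^ j.val = I ^ j.val * I ^ j.val := by
    rw [← mul_pow, Complex.I_mul_I]
  have h3 : I ^ pos j = I ^ j.val * I := by
    rw [pos, FermionSystem.I_zpow_succ, zpow_natCast]
  rw [h1, sigmaPlus_siteKinv, strand_smul, strand_siteKinv, cdag, h2, h3]
  module

lemma smul_chainF : I • chainF N = glPsi N := by
  rw [chainF, glPsi, Finset.smul_sum]
  refine Finset.sum_congr rfl fun j _ => ?_
  rw [cann, pos, FermionSystem.I_zpow_succ, zpow_natCast, smul_smul, mul_right_comm,
    mul_comm (I ^ _), I_inv_pow_mul_I_pow, one_mul]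

/-- `K` and `K⁻¹` are nonzero multiples of the parity, `i F = ψ` and `E K⁻¹ = ψ†`, so the two
families of operators have the same commutant. -/
lemma latticeW_eq_centralizer :
    latticeW N = Subalgebra.centralizer ℂ {chainParity N, glPsi N, glPsiDag N} := by
  have hgen : ∀ g, chainRep N (RingQuot.mkAlgHom ℂ (QRel I 2) (freeGen g)) = chainGen N g := by
    intro g
    rw [chainRep, RingQuot.liftAlgHom_mkAlgHom_apply, FreeAlgebra.lift_ι_apply]
  ext x
  simp only [latticeW, Subalgebra.mem_centralizer_iff, Set.forall_mem_range, Set.mem_insert_iff,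
    Set.mem_singleton_iff, forall_eq_or_imp, forall_eq]
  have hIN : I ^ N ≠ 0 := pow_ne_zero _ Complex.I_ne_zero
  have hP : ∀ r : ℂ, r ≠ 0 → ∀ y : Op N, y * x = x * y ↔ (r • y) * x = x * (r • y) := by
    intro r hr y
    rw [smul_mul_assoc, mul_smul_comm]
    exact ⟨fun h => by rw [h], fun h => smul_right_injective _ hr h⟩
  constructor
  · intro h
    have hx : ∀ g, chainGen N g * x = x * chainGen N g := fun g => by rw [← hgen]; exact h _
    refine ⟨?_, ?_, ?_⟩
    · rw [hP _ hIN, ← chainK_eq]; exact hx .genK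
    · rw [← smul_chainF, ← hP I Complex.I_ne_zero]; exact hx .genF
    · have h1 := hx .genE
      have h2 := hx .genKinv
      simp only [chainGen] at h1 h2
      rw [← chainE_mul_chainKinv, mul_assoc, h2, ← mul_assoc, h1, mul_assoc]
  · rintro ⟨h, hF, hE⟩
    have hK : chainK N * x = x * chainK N := by rw [chainK_eq, ← hP _ hIN, h]
    have hKinv : chainKinv N * x = x * chainKinv N := by
      rw [chainKinv_eq, ← hP _ (pow_ne_zero _ (inv_ne_zero Complex.I_ne_zero)), h]
    have hEeq : chainE N = glPsiDag N * chainK N := by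
      rw [← chainE_mul_chainKinv, mul_assoc, chainKinv_mul_chainK, mul_one]
    -- The commutant of `x` is a subalgebra, so it contains the whole image of the representation
    -- once it contains the generators.
    have hx : ∀ g, chainGen N g ∈ Subalgebra.centralizer ℂ {x} := by
      intro g
      simp only [Subalgebra.mem_centralizer_iff, Set.mem_singleton_iff, forall_eq]
      cases g with
      | genE =>
        change x * chainE N = chainE N * x
        rw [hEeq, mul_assoc, hK, ← mul_assoc, ← mul_assoc, hE]
      | genF =>
        change x * chainF N = chainF N * x
        rw [eq_comm, hP I Complex.I_ne_zero, smul_chainF, hF]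
      | genK => exact hK.symm
      | genKinv => exact hKinv.symm
    intro y
    obtain ⟨z, rfl⟩ := RingQuot.mkAlgHom_surjective ℂ (QRel I 2) y
    have hz : chainRep N (RingQuot.mkAlgHom ℂ (QRel I 2) z) ∈ Subalgebra.centralizer ℂ {x} := by
      rw [chainRep, RingQuot.liftAlgHom_mkAlgHom_apply]
      have hle : (FreeAlgebra.lift ℂ (chainGen N)).range ≤ Subalgebra.centralizer ℂ {x} := by
        rw [← Algebra.adjoin_range_eq_range_freeAlgebra_lift]
        refine Algebra.adjoin_le ?_
        rintro _ ⟨g, rfl⟩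
        exact hx g
      exact hle ⟨z, rfl⟩
    simp only [Subalgebra.mem_centralizer_iff, Set.mem_singleton_iff, forall_eq] at hz
    exact hz.symm

lemma totalSpin_eq : totalSpin N = ∑ j : Fin N, cdag j * cann j - ((N : ℂ) / 2) • 1 := by
  have h : ∀ j : Fin N, strand N 1 sigmaZ 1 j = (2 : ℂ) • (cdag j * cann j) + (-1 : ℂ) • 1 :=
    fun j => by
      rw [sigmaZ_eq, strand_add, strand_smul, strand_smul, strand_one, cdag_mul_cann_self]
  simp only [totalSpin, h, Finset.sum_add_distrib, Finset.sum_const, Finset.card_univ,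
    Fintype.card_fin, ← Finset.smul_sum, ← Nat.cast_smul_eq_nsmul ℂ N]
  module

lemma glCommutant_eq_centralizer (n : ℕ) : glCommutant (n + 1)
    = Subalgebra.centralizer ℂ {(chainFermions n).psiDag, (chainFermions n).psi,
      (chainFermions n).number} := by
  have h : totalSpin (n + 1) = (chainFermions n).number - (((n + 1 : ℕ) : ℂ) / 2) • 1 :=
    totalSpin_eq
  have h' : ∀ x, totalSpin (n + 1) * x = x * totalSpin (n + 1) ↔
      (chainFermions n).number * x = x * (chainFermions n).number := by
    intro x
    rw [h, sub_mul, mul_sub, smul_mul_assoc, one_mul, mul_smul_comm, mul_one, sub_left_inj]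
  ext x
  simp only [glCommutant, Subalgebra.mem_centralizer_iff, Set.mem_insert_iff,
    Set.mem_singleton_iff, forall_eq_or_imp, forall_eq, h']
  rfl

end Chain

/-! ### The local generators as bilinears in bond fermions -/

namespace FermionSystem

variable {n : ℕ} {A : Type*} [Ring A] [Algebra ℂ A] (F : FermionSystem n A)

lemma c_mul_cd_of_ne {j k : Fin (n + 1)} (h : j ≠ k) : F.c j * F.cd k = -(F.cd k * F.c j) := by
  have := F.c_cd j k
  rw [if_neg h, zero_smul] at this
  exact eq_neg_of_add_eq_zero_left this

lemma smul_bondDag_mul_bond (k : Fin n) :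
    F.c k.castSucc * F.cd k.succ + F.c k.succ * F.cd k.castSucc
      + I • (F.cd k.castSucc * F.c k.castSucc - F.cd k.succ * F.c k.succ)
      = I • (F.bondDag k * F.bond k) := by
  have hne : k.castSucc ≠ k.succ := (Fin.castSucc_lt_succ).ne
  rw [F.c_mul_cd_of_ne hne, F.c_mul_cd_of_ne hne.symm, bond, bondDag]
  simp only [add_mul, mul_add, smul_mul_assoc, mul_smul_comm, smul_add, smul_sub, smul_smul,
    Complex.I_mul_I]
  module

lemma bondDag_mul_bondDag {j k : Fin n} (h : j.succ = k.castSucc) :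
    F.bondDag j * F.bondDag k = F.cd j.castSucc * F.cd j.succ
      + I • (F.cd j.castSucc * F.cd k.succ) - F.cd j.succ * F.cd k.succ := by
  rw [bondDag, bondDag, ← h]
  simp only [add_mul, mul_add, smul_mul_assoc, mul_smul_comm, smul_add, smul_smul,
    Complex.I_mul_I, F.cd_sq]
  module

lemma bondDag_mul_bond_add {j k : Fin n} (h : j.succ = k.castSucc) :
    I • (F.bondDag j * F.bond k + F.bondDag k * F.bond j) =
      I • (F.cd j.castSucc * F.c j.succ) - F.cd j.castSucc * F.c k.succ
      + I • (F.cd j.succ * F.c j.castSucc)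
      - (2 : ℂ) • (F.cd j.succ * F.c j.succ) - I • (F.cd j.succ * F.c k.succ)
      - F.cd k.succ * F.c j.castSucc - I • (F.cd k.succ * F.c j.succ) := by
  rw [bond, bondDag, bond, bondDag, ← h]
  simp only [add_mul, mul_add, smul_mul_assoc, mul_smul_comm, smul_add, smul_smul,
    Complex.I_mul_I]
  module

lemma permutation_eq {j k : Fin n} (h : j.succ = k.castSucc) :
    (F.c j.castSucc + F.c k.succ) * (F.cd j.castSucc + F.cd k.succ) - 1
      = 1 - F.bondDag j * F.bond j + F.bondDag k * F.bond k
        + I • (F.bondDag j * F.bond k + F.bondDag k * F.bond j) := by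
  -- The middle site drops out of `aⱼ - i aₖ`, which leaves the two outer sites.
  have h1 : F.c j.castSucc + F.c k.succ = F.bond j - I • F.bond k := by
    rw [bond, bond, ← h, smul_add, smul_smul, Complex.I_mul_I]; module
  have h2 : F.cd j.castSucc + F.cd k.succ = F.bondDag j - I • F.bondDag k := by
    rw [bondDag, bondDag, ← h, smul_add, smul_smul, Complex.I_mul_I]; module
  have hjk : j.val + 1 = k.val := by simpa using congrArg Fin.val h
  have h3 : F.bond j * F.bondDag k = I • 1 - F.bondDag k * F.bond j := by
    rw [eq_sub_iff_add_eq, F.bond_bondDag, overlap, if_pos (Or.inl hjk)]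
  have h4 : F.bond k * F.bondDag j = I • 1 - F.bondDag j * F.bond k := by
    rw [eq_sub_iff_add_eq, F.bond_bondDag, overlap, if_pos (Or.inr hjk)]
  rw [h1, h2]
  simp only [sub_mul, mul_sub, smul_mul_assoc, mul_smul_comm, h3, h4, bond_mul_bondDag_self,
    smul_sub, smul_add, smul_smul, Complex.I_mul_I]
  module

end FermionSystem

/-! ### The algebras generated on the chain -/

section Generators

variable {n : ℕ}

lemma exists_bond {j k : Fin (n + 1)} (h : j.val + 1 = k.val) :
    ∃ b : Fin n, j = b.castSucc ∧ k = b.succ :=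
  ⟨⟨j.val, by omega⟩, Fin.ext rfl, Fin.ext h.symm⟩

lemma tlGen_eq (b : Fin n) : tlGen b.castSucc b.succ
    = I • ((chainFermions n).bondDag b * (chainFermions n).bond b) :=
  (chainFermions n).smul_bondDag_mul_bond b

lemma wbPlus_eq {b d : Fin n} (h : b.succ = d.castSucc) : wbPlus b.castSucc b.succ d.succ
    = (-1 : ℂ) ^ pos b.castSucc • ((chainFermions n).bondDag b * (chainFermions n).bondDag d) := by
  rw [(chainFermions n).bondDag_mul_bondDag h]
  rfl

lemma wbMinus_eq {b d : Fin n} (h : b.succ = d.castSucc) : wbMinus b.castSucc b.succ d.succ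
    = (-1 : ℂ) ^ (pos b.castSucc + 1) •
      ((chainFermions n).bond b * (chainFermions n).bond d) := by
  have := (chainFermions n).swap.bondDag_mul_bondDag h
  simp only [FermionSystem.swap_bondDag] at this
  rw [this]
  rfl

lemma wbZero_eq {b d : Fin n} (h : b.succ = d.castSucc) : wbZero b.castSucc b.succ d.succ
    = (-(1 / 2) : ℂ) • (1 + I • ((chainFermions n).bondDag b * (chainFermions n).bond d
      + (chainFermions n).bondDag d * (chainFermions n).bond b)) := by
  rw [(chainFermions n).bondDag_mul_bond_add h, wbZero]
  simp only [chainFermions_c, chainFermions_cd]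
  congr 1
  abel

lemma wbPerm_eq {b d : Fin n} (h : b.succ = d.castSucc) :
    wbPerm b.castSucc d.succ = 1 - (chainFermions n).bondDag b * (chainFermions n).bond b
      + (chainFermions n).bondDag d * (chainFermions n).bond d
      + I • ((chainFermions n).bondDag b * (chainFermions n).bond d
        + (chainFermions n).bondDag d * (chainFermions n).bond b) :=
  (chainFermions n).permutation_eq h

lemma bondDag_mul_bond_mem_of_tl (S : Subalgebra ℂ (Op (n + 1))) (hS : tlGenerators (n + 1) ⊆ S)
    (b : Fin n) : (chainFermions n).bondDag b * (chainFermions n).bond b ∈ S := by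
  have h : tlGen b.castSucc b.succ ∈ S := hS ⟨_, _, by simp, rfl⟩
  rw [tlGen_eq] at h
  have := S.smul_mem h I⁻¹
  rwa [inv_smul_smul₀ Complex.I_ne_zero] at this

lemma succ_eq_castSucc {b d : Fin n} (h : b.val + 1 = d.val) : b.succ = d.castSucc :=
  Fin.ext (by simpa using h)

/-- Up to nonzero scalars, and the identity in `WB⁰`, the generators are exactly the neighbouring
bilinears from which `quad_le` builds everything. -/
lemma adjoin_tl_w_eq_quad :
    Algebra.adjoin ℂ (tlGenerators (n + 1) ∪ wGenerators (n + 1)) = (chainFermions n).quad := by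
  set F := chainFermions n with hF
  set S := Algebra.adjoin ℂ (tlGenerators (n + 1) ∪ wGenerators (n + 1)) with hS
  apply le_antisymm
  · refine Algebra.adjoin_le ?_
    rintro _ (⟨j, k, hjk, rfl⟩ | ⟨j, k, l, hjk, hkl, h⟩)
    · obtain ⟨b, rfl, rfl⟩ := exists_bond hjk
      rw [tlGen_eq]
      exact F.quad.smul_mem (F.mul_mem_quad (F.bondDag_mem b) (F.bond_mem b)) _
    · obtain ⟨b, rfl, rfl⟩ := exists_bond hjk
      obtain ⟨d, hbd, rfl⟩ := exists_bond hkl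
      rcases h with rfl | rfl | rfl
      · rw [wbPlus_eq hbd]
        exact F.quad.smul_mem (F.mul_mem_quad (F.bondDag_mem b) (F.bondDag_mem d)) _
      · rw [wbZero_eq hbd]
        exact F.quad.smul_mem (add_mem (one_mem _) (F.quad.smul_mem
          (add_mem (F.mul_mem_quad (F.bondDag_mem b) (F.bond_mem d))
            (F.mul_mem_quad (F.bondDag_mem d) (F.bond_mem b))) _)) _
      · rw [wbMinus_eq hbd]
        exact F.quad.smul_mem (F.mul_mem_quad (F.bond_mem b) (F.bond_mem d)) _
  · have hneg : (-1 : ℂ) ≠ 0 := by norm_num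
    have hw : ∀ {b d : Fin n}, b.val + 1 = d.val → ∀ {x}, (x = wbPlus b.castSucc b.succ d.succ ∨
        x = wbZero b.castSucc b.succ d.succ ∨ x = wbMinus b.castSucc b.succ d.succ) → x ∈ S :=
      fun hbd x hx => Algebra.subset_adjoin (Or.inr ⟨_, _, _, by simp, by simp [hbd], hx⟩)
    refine F.quad_le S
      (bondDag_mul_bond_mem_of_tl S fun x hx => Algebra.subset_adjoin (Or.inl hx)) ?_ ?_ ?_
    · intro b d hbd
      have h := hw hbd (Or.inr (Or.inl rfl))
      rw [wbZero_eq (succ_eq_castSucc hbd)] at h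
      have h1 := S.smul_mem h (-(1 / 2) : ℂ)⁻¹
      rw [inv_smul_smul₀ (by norm_num)] at h1
      have h2 := S.smul_mem (sub_mem h1 (one_mem S)) I⁻¹
      rwa [add_sub_cancel_left, inv_smul_smul₀ Complex.I_ne_zero] at h2
    · intro b d hbd
      have h := hw hbd (Or.inr (Or.inr rfl))
      rw [wbMinus_eq (succ_eq_castSucc hbd)] at h
      have h1 := S.smul_mem h ((-1 : ℂ) ^ (pos b.castSucc + 1))⁻¹
      rwa [inv_smul_smul₀ (zpow_ne_zero _ hneg)] at h1
    · intro b d hbd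
      have h := hw hbd (Or.inl rfl)
      rw [wbPlus_eq (succ_eq_castSucc hbd)] at h
      have h1 := S.smul_mem h ((-1 : ℂ) ^ pos b.castSucc)⁻¹
      rwa [inv_smul_smul₀ (zpow_ne_zero _ hneg)] at h1

/-- Removing from `WBⱼ` the identity and the two number operators, which come from the
Temperley–Lieb generators, leaves the symmetric hop; transport along the chain gives the other hops.
-/
lemma walledBrauer_eq_hopAlg : walledBrauer (n + 1) = (chainFermions n).hopAlg := by
  set F := chainFermions n with hF
  apply le_antisymm
  · refine Algebra.adjoin_le ?_
    rintro _ (⟨j, k, hjk, rfl⟩ | ⟨j, l, hjl, rfl⟩)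
    · obtain ⟨b, rfl, rfl⟩ := exists_bond hjk
      rw [tlGen_eq]
      exact F.hopAlg.smul_mem (F.hop_mem b b) _
    · obtain ⟨b, rfl, hb⟩ := exists_bond (j := j) (k := ⟨j.val + 1, by omega⟩) rfl
      obtain ⟨d, hd, rfl⟩ := exists_bond (j := ⟨b.val + 1, by omega⟩) (k := l) (by simpa using hjl)
      rw [wbPerm_eq (Fin.ext (by simpa using congrArg Fin.val hd))]
      exact add_mem (add_mem (sub_mem (one_mem _) (F.hop_mem b b)) (F.hop_mem d d))
        (F.hopAlg.smul_mem (add_mem (F.hop_mem b d) (F.hop_mem d b)) _)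
  · have hS := bondDag_mul_bond_mem_of_tl (walledBrauer (n + 1))
      fun x hx => Algebra.subset_adjoin (Or.inl hx)
    refine Algebra.adjoin_le ?_
    rintro _ ⟨j, l, rfl⟩
    refine F.bondDag_mul_bond_mem _ hS (fun b d hbd => ?_) j l
    have h : wbPerm b.castSucc d.succ ∈ walledBrauer (n + 1) :=
      Algebra.subset_adjoin (Or.inr ⟨_, _, by simp; omega, rfl⟩)
    rw [wbPerm_eq (succ_eq_castSucc hbd)] at h
    have h1 := sub_mem h (add_mem (sub_mem (one_mem _) (hS b)) (hS d))
    rw [add_sub_cancel_left] at h1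
    have h2 := (walledBrauer (n + 1)).smul_mem h1 I⁻¹
    rwa [inv_smul_smul₀ Complex.I_ne_zero] at h2

lemma divE_eq : divE (n + 1) = (chainFermions n).raising := by
  rw [divE, FermionSystem.raising, FermionSystem.pairing, Finset.smul_sum]
  refine Finset.sum_congr rfl fun j _ => ?_
  rw [Finset.smul_sum]
  refine Finset.sum_congr rfl fun k _ => ?_
  rw [smul_smul, chainFermions_cd]
  congr 1
  -- With `m` the sum of the two site numbers, `(-1)ᵐ i^{1-m} = i²ᵐ i^{1-m} = i · iᵐ`.
  have h1 : (-1 : ℂ) ^ (pos j + pos k) = I ^ (pos j + pos k) * I ^ (pos j + pos k) := by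
    rw [← mul_zpow, Complex.I_mul_I]
  rw [h1, mul_assoc, ← zpow_add₀ Complex.I_ne_zero, mul_comm I]
  have h2 : pos j + pos k + (1 - pos j - pos k) = 1 := by ring
  rw [h2, zpow_one]

lemma divF_eq : divF (n + 1) = (chainFermions n).lowering := by
  rw [divF, FermionSystem.lowering, FermionSystem.pairing, Finset.smul_sum]
  refine Finset.sum_congr rfl fun j _ => ?_
  rw [Finset.smul_sum]
  refine Finset.sum_congr rfl fun k _ => ?_
  rw [smul_smul, FermionSystem.swap_cd, chainFermions_c, zpow_sub_one₀ Complex.I_ne_zero,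
    Complex.inv_I, mul_comm]
  rfl

end Generators

end XXChain

end

/-! ### Assembly of the theorem -/

theorem mainTheorem1 (N : ℕ) (hN : 1 ≤ N) :
    XXChain.latticeW N
        = Algebra.adjoin ℂ (XXChain.tlGenerators N ∪ XXChain.wGenerators N) ∧
    XXChain.walledBrauer N = XXChain.glCommutant N ∧
    Subalgebra.toSubmodule (XXChain.latticeW N)
        = XXChain.adjointImage N (Subalgebra.toSubmodule (XXChain.walledBrauer N)) ∧
    (2 ≤ N → Module.finrank ℂ (XXChain.latticeW N) = 2 ^ (2 * N - 3)) := by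
  obtain ⟨n, rfl⟩ : ∃ n, N = n + 1 := ⟨N - 1, by omega⟩
  have hW : XXChain.latticeW (n + 1) = (XXChain.chainFermions n).quad := by
    rw [XXChain.latticeW_eq_centralizer, XXChain.FermionSystem.quad_eq_centralizer]
    rfl
  refine ⟨?_, ?_, ?_, fun hn => ?_⟩
  · rw [hW, XXChain.adjoin_tl_w_eq_quad]
  · rw [XXChain.walledBrauer_eq_hopAlg, XXChain.FermionSystem.hopAlg_eq_centralizer,
      XXChain.glCommutant_eq_centralizer]
  · rw [hW, XXChain.FermionSystem.quad_eq_span, XXChain.adjointImage,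
      XXChain.walledBrauer_eq_hopAlg, XXChain.adjointSl2, XXChain.divE_eq, XXChain.divF_eq]
    rfl
  · have h := (XXChain.chainFermions n).finrank_quad (by omega)
    rw [XXChain.finrank_op, ← hW] at h
    -- The truncated subtraction is exact because `N ≥ 2`; splitting off `2³` lets the factor `8`
    -- cancel.
    have h2 : 2 * (n + 1) = 3 + (2 * (n + 1) - 3) := by omega
    rw [h2, pow_add] at h
    omega
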